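/- **Setting.** Let $\Sigma$ be a compact $3$-dimensional manifold with boundary, with an ideal triangulation $\mathcal T$: finitely many tetrahedra whose faces are glued in pairs by affine homeomorphisms such that $\Sigma$ is homeomorphic to the quotient of the corresponding truncated tetrahedra (small open neighbourhoods of the vertices removed). Let $V$ be the set of (ideal) vertices of $\mathcal T$, that is, of classes of vertices of tetrahedra under the gluing; they correspond to the connected components of $\partial\Sigma$. Put $N=|V|$. A *hyper-ideal tetrahedron* is a tetrahedron in the Klein model of $\mathbb H^3$ whose vertices lie outside the closed ball and whose edges all meet the ball, truncated by the polar planes of its vertices; the length of the edge $\{ij\}$ is the distance $l_{ij}>0$ between the polar planes of $i$ and $j$. A *generalized sphere packing metric* is a function $r:V\to(0,\infty)$ such that for every tetrahedron $\{ijkh\}$ of $\mathcal T$ the numbers $l_{ij}=r_i+r_j$ are the edge lengths of a non-degenerate hyper-ideal tetrahedron. Let $\Omega\subset\mathbb R^N$ be the set of these metrics. For $r\in\Omega$ let $\beta_{ij,kh}$ be the dihedral angle at the edge $\{ij\}$ of the hyper-ideal tetrahedron $\{ijkh\}$. The *combinatorial scalar curvature* at $i\in V$ is $$K_i(r)=\sum_{j\sim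 i}\Big(2\pi-\sum_{\{ijkh\}\in\mathcal T}\beta_{ij,kh}\Big),$$ where the outer sum is over the edges of $\mathcal T$ emanating from $i$ (an edge with both ends at $i$ counts twice) and the inner sum is over the tetrahedra around that edge, with multiplicity. Let $\Delta=\big(\partial K_i/\partial r_j\big)_{i,j\in V}$, and let $\|\cdot\|$ be the maximum norm on $\mathbb R^N$. Given $\bar K\in\mathbb R^N$, consider, for curves $r(t)\in\Omega$, the combinatorial Ricci flow $$\frac{dr}{dt}=K(r)-\bar K\qquad(1)$$ and the combinatorial Calabi flow $$\frac{dr}{dt}=-\Delta\,(K(r)-\bar K).\qquad(2)$$ **Theorem 5.1.** (a) If a solution $r:[0,\infty)\to\Omega$ of (1) or of (2) converges, as $t\to\infty$, to a point of $\Omega$, then there is a generalized sphere packing metric $\bar r\in\Omega$ with $K(\bar r)=\bar K$. (b) If $\bar r\in\Omega$ satisfies $K(\bar r)=\bar K$, then there is $\delta>0$ such that for every $r_0\in\Omega$ with $\|K(r_0)-\bar K\|<\delta$, each of the flows (1) and (2) with $r(0)=r_0$ has a solution $r:[0,\infty)\to\Omega$ for all time, which is unique (every solution in $\Omega$ on an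 interval $[0,S)$ with the same initial value agrees with it there), and which converges exponentially fast to $\bar r$: there are $C,a>0$ with $\|r(t)-\bar r\|\le Ce^{-at}$ for all $t\ge 0$. -/

import Mathlib

open Set Filter Topology

/-! ### Hyper-ideal tetrahedra -/

namespace HyperIdeal

/-- The Lorentzian bilinear form of signature `(3,1)` on `ℝ⁴`. Hyperbolic 3-space is the projectivised
cone of timelike vectors (`lor x x < 0`), i.e. the ball of the Klein model. -/
def lor (x y : Fin 4 → ℝ) : ℝ := x 0 * y 0 + x 1 * y 1 + x 2 * y 2 - x 3 * y 3

/-- `v 0, …, v 3` are the hyper-ideal vertices of a non-degenerate hyper-ideal tetrahedron with edge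
lengths `l i j`. The projective points `[v i]` lie outside the closed ball of the Klein model and span
a tetrahedron with non-empty interior, all of whose edges meet the ball; the compact hyper-ideal
tetrahedron is obtained by cutting this tetrahedron along the four polar planes `(v i)^⊥`, which carry
the vertex triangles and are orthogonal to the faces through `v i`. The planes `(v i)^⊥` and
`(v j)^⊥` are at distance `l i j`, realised along the edge from `v i` to `v j`, exactly when
`lor (v i) (v j) = - cosh (l i j)`. Linear dependence of the `v i` is the flat (degenerate) case. -/
structure IsHyperidealTetrahedron (l : Fin 4 → Fin 4 → ℝ) (v : Fin 4 → Fin 4 → ℝ) : Prop where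
  unit : ∀ i, lor (v i) (v i) = 1
  length_pos : ∀ i j, i ≠ j → 0 < l i j
  length : ∀ i j, i ≠ j → lor (v i) (v j) = -Real.cosh (l i j)
  nondegenerate : LinearIndependent ℝ v

/-- The numbers `l i j` are the edge lengths of a non-degenerate hyper-ideal tetrahedron. -/
def Realizable (l : Fin 4 → Fin 4 → ℝ) : Prop := ∃ v, IsHyperidealTetrahedron l v

/-- The component of `x` orthogonal (for `lor`) to the plane spanned by `a` and `b`, for unit
spacelike `a`, `b` with `lor a b < -1`. The plane is then Lorentzian, and its
orthogonal complement is Euclidean. -/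
noncomputable def orthComp (a b x : Fin 4 → ℝ) : Fin 4 → ℝ :=
  x - ((lor x a - lor a b * lor x b) / (1 - lor a b ^ 2)) • a
    - ((lor x b - lor a b * lor x a) / (1 - lor a b ^ 2)) • b

/-- The smaller of the two elements of `Fin 4` different from `i` and `j` (for `i ≠ j`). -/
def other₁ (i j : Fin 4) : Fin 4 :=
  if i ≠ 0 ∧ j ≠ 0 then 0 else if i ≠ 1 ∧ j ≠ 1 then 1 else 2

/-- The larger of the two elements of `Fin 4` different from `i` and `j` (for `i ≠ j`). -/
def other₂ (i j : Fin 4) : Fin 4 :=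
  if i ≠ 3 ∧ j ≠ 3 then 3 else if i ≠ 2 ∧ j ≠ 2 then 2 else 1

theorem other_spec : ∀ i j : Fin 4, i ≠ j →
    other₁ i j ≠ i ∧ other₁ i j ≠ j ∧ other₂ i j ≠ i ∧ other₂ i j ≠ j ∧
      other₁ i j < other₂ i j := by
  decide

/-- The interior dihedral angle at the edge `{i,j}` of the tetrahedron with vertices `v`: with
`{k,h}` the other two vertices, it is the angle between the half-planes bounded by the line `ij` that
contain the faces `ijk` and `ijh`, measured in the Euclidean plane orthogonal to the edge. -/
noncomputable def dihedral (v : Fin 4 → Fin 4 → ℝ) (i j : Fin 4) : ℝ :=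
  Real.arccos
    (lor (orthComp (v i) (v j) (v (other₁ i j))) (orthComp (v i) (v j) (v (other₂ i j))) /
      (√(lor (orthComp (v i) (v j) (v (other₁ i j))) (orthComp (v i) (v j) (v (other₁ i j)))) *
        √(lor (orthComp (v i) (v j) (v (other₂ i j))) (orthComp (v i) (v j) (v (other₂ i j))))))

theorem lor_sub_sub (a b x y : Fin 4 → ℝ) (p q p' q' : ℝ) :
    lor (x - p • a - q • b) (y - p' • a - q' • b) =
      lor x y - p' * lor x a - q' * lor x b - p * lor y a - q * lor y b
        + p * p' * lor a a + (p * q' + q * p') * lor a b + q * q' * lor b b := by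
  simp only [lor, Pi.sub_apply, Pi.smul_apply, smul_eq_mul]
  ring

/-- The dihedral angles depend only on the edge lengths, not on the realization. -/
theorem dihedral_eq {l v w} (hv : IsHyperidealTetrahedron l v) (hw : IsHyperidealTetrahedron l w)
    (i j : Fin 4) : dihedral v i j = dihedral w i j := by
  have key : ∀ a b, lor (v a) (v b) = lor (w a) (w b) := by
    intro a b
    by_cases h : a = b
    · subst h; rw [hv.unit, hw.unit]
    · rw [hv.length a b h, hw.length a b h]
  simp only [dihedral, orthComp, lor_sub_sub, key]

open Classical in
/-- The dihedral angle at the edge `{i,j}` of the hyper-ideal tetrahedron with edge lengths `l`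
(the value `0` for non-realizable `l` is never used). -/
noncomputable def angle (l : Fin 4 → Fin 4 → ℝ) (i j : Fin 4) : ℝ :=
  if h : Realizable l then dihedral h.choose i j else 0

end HyperIdeal

/-! ### Ideal triangulations -/

/-- A pairing of the faces of a family `T` of (labelled) tetrahedra. The face of `σ` opposite to
its vertex `f` is glued to another face, namely the face of `adj σ f` opposite to the vertex
`perm σ f f`, by the affine map that sends the vertex `v ≠ f` of `σ` to the vertex `perm σ f v`
of `adj σ f`. -/
structure FacePairing (T : Type*) where
  adj : T → Fin 4 → T
  perm : T → Fin 4 → Equiv.Perm (Fin 4)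
  adj_adj : ∀ σ f, adj (adj σ f) (perm σ f f) = σ
  perm_perm : ∀ σ f, perm (adj σ f) (perm σ f f) = (perm σ f)⁻¹
  no_fixed : ∀ σ f, (adj σ f, perm σ f f) ≠ (σ, f)

/-- The truncated tetrahedron: the standard simplex (barycentric coordinates) without small open
neighbourhoods of its four vertices. -/
def TruncatedTetrahedron : Type :=
  {x : Fin 4 → ℝ // x ∈ stdSimplex ℝ (Fin 4) ∧ ∀ v, x v ≤ 2 / 3}

instance : TopologicalSpace TruncatedTetrahedron :=
  inferInstanceAs (TopologicalSpace {x : Fin 4 → ℝ // x ∈ stdSimplex ℝ (Fin 4) ∧ ∀ v, x v ≤ 2 / 3})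

namespace FacePairing

variable {T : Type*} (G : FacePairing T)

/-- Points of truncated tetrahedra that are identified by the gluing of a pair of faces. -/
def PointRel (p q : Σ _ : T, TruncatedTetrahedron) : Prop :=
  ∃ f : Fin 4, p.2.1 f = 0 ∧ q.1 = G.adj p.1 f ∧ ∀ v, q.2.1 (G.perm p.1 f v) = p.2.1 v

/-- The space obtained from the truncated tetrahedra by gluing their faces; it carries the quotient
topology. -/
def TruncatedSpace : Type _ := Quot G.PointRel

instance : TopologicalSpace G.TruncatedSpace :=
  inferInstanceAs (TopologicalSpace (Quot G.PointRel))

/-- Vertices of tetrahedra that are identified by the gluing of a pair of faces. -/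
def VertexRel (a b : T × Fin 4) : Prop :=
  ∃ f, f ≠ a.2 ∧ b = (G.adj a.1 f, G.perm a.1 f a.2)

/-- The set `V` of ideal vertices: classes of vertices of tetrahedra under the gluing. They
correspond to the boundary components of the glued space. -/
def Vertex : Type _ := Quot G.VertexRel

/-- An oriented edge `(σ, i, j)` of a tetrahedron, from its vertex `i` to its vertex `j`. -/
abbrev OEdge (T : Type*) : Type _ := {c : T × Fin 4 × Fin 4 // c.2.1 ≠ c.2.2}

/-- Oriented edges of tetrahedra that are identified by the gluing of a pair of faces. -/
def EdgeRel (a b : OEdge T) : Prop :=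
  ∃ f, f ≠ a.1.2.1 ∧ f ≠ a.1.2.2 ∧
    b.1 = (G.adj a.1.1 f, G.perm a.1.1 f a.1.2.1, G.perm a.1.1 f a.1.2.2)

/-- Oriented edges of the triangulation: classes of oriented edges of tetrahedra. -/
def OrientedEdge : Type _ := Quot G.EdgeRel

/-- The initial vertex of an oriented edge of the triangulation. -/
def OrientedEdge.source : G.OrientedEdge → G.Vertex :=
  Quot.lift (fun a => Quot.mk _ (a.1.1, a.1.2.1)) (by
    rintro a b ⟨f, h1, _, h3⟩
    apply Quot.sound
    exact ⟨f, h1, by rw [h3]⟩)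

instance [Finite T] : Finite G.Vertex := inferInstanceAs (Finite (Quot G.VertexRel))

instance [Finite T] : Finite G.OrientedEdge := inferInstanceAs (Finite (Quot G.EdgeRel))

noncomputable instance [Finite T] : Fintype G.Vertex := Fintype.ofFinite _

noncomputable instance [Finite T] : Fintype G.OrientedEdge := Fintype.ofFinite _

noncomputable instance [Finite T] : Fintype (OEdge T) := Fintype.ofFinite _

/-- The edge lengths `l_{ij} = r_i + r_j` of the tetrahedron `σ`. -/
def length (r : G.Vertex → ℝ) (σ : T) (i j : Fin 4) : ℝ :=
  r (Quot.mk _ (σ, i)) + r (Quot.mk _ (σ, j))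

/-- Generalized sphere packing metrics: positive functions on `V` whose edge lengths
`l_{ij} = r_i + r_j` determine a non-degenerate hyper-ideal tetrahedron for every tetrahedron. -/
def IsMetric (r : G.Vertex → ℝ) : Prop :=
  (∀ i, 0 < r i) ∧ ∀ σ, HyperIdeal.Realizable (G.length r σ)

variable [Finite T]

open Classical in
/-- The combinatorial Ricci curvature along an edge: `2π` minus the sum of the dihedral angles of
all tetrahedra along this edge. -/
noncomputable def ricciCurvature (r : G.Vertex → ℝ) (e : G.OrientedEdge) : ℝ :=
  2 * Real.pi -
    ∑ a : OEdge T with (Quot.mk _ a : G.OrientedEdge) = e,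
      HyperIdeal.angle (G.length r a.1.1) a.1.2.1 a.1.2.2

open Classical in
/-- The combinatorial scalar curvature at the vertex `i`: the sum of the combinatorial Ricci
curvatures of the edges emanating from `i` (an edge with both ends at `i` emanates twice). -/
noncomputable def scalarCurvature (r : G.Vertex → ℝ) (i : G.Vertex) : ℝ :=
  ∑ e : G.OrientedEdge with OrientedEdge.source G e = i, G.ricciCurvature r e

open Classical in
/-- The generalized discrete Laplace operator `Δ = (∂K_i/∂r_j)`. -/
noncomputable def laplacian (r : G.Vertex → ℝ) : Matrix G.Vertex G.Vertex ℝ :=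
  Matrix.of fun i j => deriv (fun s => G.scalarCurvature (Function.update r j s) i) (r j)

/-- Right-hand side of the combinatorial Ricci flow with target curvature `Kbar`. -/
noncomputable def ricciField (Kbar r : G.Vertex → ℝ) : G.Vertex → ℝ :=
  G.scalarCurvature r - Kbar

/-- Right-hand side of the combinatorial Calabi flow with target curvature `Kbar`. -/
noncomputable def calabiField (Kbar r : G.Vertex → ℝ) : G.Vertex → ℝ :=
  -(G.laplacian r).mulVec (G.scalarCurvature r - Kbar)

/-- `r` is a solution, on the time interval `J`, of `dr/dt = F r` in the space of generalized sphere
packing metrics (with one-sided derivatives at the endpoints of `J` that belong to `J`). -/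
def IsFlow (F : (G.Vertex → ℝ) → G.Vertex → ℝ) (J : Set ℝ) (r : ℝ → G.Vertex → ℝ) : Prop :=
  ∀ t ∈ J, G.IsMetric (r t) ∧ HasDerivWithinAt r (F (r t)) J t

/-- The solution of `dr/dt = F r` with initial value `r₀` is unique on every interval `[0,S)`, exists
for all time `t ≥ 0`, and converges exponentially fast to `rbar`. -/
def FlowConvergesExp (F : (G.Vertex → ℝ) → G.Vertex → ℝ) (r₀ rbar : G.Vertex → ℝ) : Prop :=
  ∃ r : ℝ → G.Vertex → ℝ,
    r 0 = r₀ ∧ G.IsFlow F (Ici 0) r ∧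
    (∀ (S : ℝ) (q : ℝ → G.Vertex → ℝ), 0 < S → q 0 = r₀ → G.IsFlow F (Ico 0 S) q →
      EqOn q r (Ico 0 S)) ∧
    ∃ C > 0, ∃ a > 0, ∀ t ≥ 0, ‖r t - rbar‖ ≤ C * Real.exp (-a * t)

end FacePairing

/-- An ideal triangulation, with set of tetrahedra `T`, of the space `M`: a face pairing of the
tetrahedra together with a homeomorphism from `M` to the space glued from the truncated
tetrahedra. -/
structure IdealTriangulation (M : Type*) [TopologicalSpace M] (T : Type*) extends
    FacePairing T where
  homeo : M ≃ₜ toFacePairing.TruncatedSpace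

/-! ### Realization and dihedral angles of a tetrahedron given by vertex radii -/

namespace HyperIdeal

/-! Everything rests on `K` having a symmetric, negative definite derivative on a convex open
domain. Put `t i = tanh (r i)`. With edge lengths `r i + r j` the Gram matrix of the hyper-ideal
vertices has entries `cosh (r i) * cosh (r j) * (±1 - t i * t j)`, plus on the diagonal. Up to the
factors `cosh`, it is a fixed matrix plus a rank-one term, governed by the single quantity `discr
t`, which is positive for all positive radii. Hence every positive `r` is a metric
(`realizable_add`), so `Ω` is the open positive orthant.

The dihedral angle at an edge splits as a sum of two face angles `arctan (slope t h)`, one for each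
face containing the edge (`dihedral_eq_arctan`). The angle sum at a vertex `i` is therefore twice
the sum of the face angles with `h ≠ i`. The derivative of these sums is, up to a positive factor,
the form `jacobianForm`. It is symmetric and nondegenerate for all `t` in `[0,1)`, and visibly
positive at `t = 0`; deforming `t` to `0` through `s • t` keeps it positive definite
(`posDef_of_path`, `jacobianForm_pos`). Summing over tetrahedra gives `-DK` positive definite
(`hessianForm_pos`, `dotProduct_fderiv_scalarCurvature`).

At an equilibrium, the linearizations `DK` and `-(DK)²` of the two flows are thus negative definite.
The squared Euclidean distance to `rbar` then decays exponentially near `rbar`, which gives global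
existence and convergence (`exists_solution_of_dissipative`). Strict monotonicity of `K` along
segments of `Ω` turns closeness of curvatures into closeness of metrics
(`exists_norm_sub_lt_of_norm_image_sub_lt`). For part (a), a limit of a trajectory is a zero of the
vector field, and injectivity of `DK` handles the Calabi flow. -/

theorem lor_orthComp {a b : Fin 4 → ℝ} (ha : lor a a = 1) (hb : lor b b = 1)
    (hab : 1 - lor a b ^ 2 ≠ 0) (x y : Fin 4 → ℝ) :
    lor (orthComp a b x) (orthComp a b y) =
      lor x y - (lor x a * lor y a + lor x b * lor y b
        - lor a b * (lor x a * lor y b + lor x b * lor y a)) / (1 - lor a b ^ 2) := by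
  simp only [orthComp, lor_sub_sub, ha, hb]
  field_simp
  ring

theorem univ_eq_other {i j : Fin 4} (hij : i ≠ j) :
    (Finset.univ : Finset (Fin 4)) = {i, j, other₁ i j, other₂ i j} := by
  revert i j; decide

theorem sum_eq_other {i j : Fin 4} (hij : i ≠ j) (f : Fin 4 → ℝ) :
    ∑ k, f k = f i + f j + f (other₁ i j) + f (other₂ i j) := by
  obtain ⟨h1, h2, h3, h4, h5⟩ := other_spec i j hij
  rw [univ_eq_other hij, Finset.sum_insert, Finset.sum_insert, Finset.sum_insert,
    Finset.sum_singleton]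
  · ring
  · simp [h5.ne]
  · simp [h2.symm, h4.symm]
  · simp [hij, h1.symm, h3.symm]

/-- The discriminant of the tetrahedron whose vertex radii have hyperbolic tangents `t`: it is
proportional to minus the determinant of the Gram matrix. -/
noncomputable def discr (t : Fin 4 → ℝ) : ℝ := 4 + (∑ i, t i) ^ 2 - 2 * ∑ i, t i ^ 2

/-- The tangent of the angle between the face opposite to `h` and the planes through its edges and
the centre of the sphere tangent to all edges. -/
noncomputable def slope (t : Fin 4 → ℝ) (h : Fin 4) : ℝ := (∑ i, t i - 2 * t h) / √(discr t)

theorem discr_pos {t : Fin 4 → ℝ} (h0 : ∀ i, 0 ≤ t i) (h1 : ∀ i, t i < 1) : 0 < discr t := by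
  have hs : ∀ i, t i ^ 2 < 1 := fun i => by nlinarith [h0 i, h1 i]
  have hp : ∀ i j, 0 ≤ t i * t j := fun i j => mul_nonneg (h0 i) (h0 j)
  simp only [discr, Fin.sum_univ_four]
  nlinarith [hs 0, hs 1, hs 2, hs 3, hp 0 1, hp 0 2, hp 0 3, hp 1 2, hp 1 3, hp 2 3]

/-- The two face angles along an edge add up to the dihedral angle with the expected cosine. -/
theorem arccos_slope {a b : ℝ} (hab : 0 ≤ a + b) :
    Real.arccos ((1 - a * b) / (√(1 + a ^ 2) * √(1 + b ^ 2))) = Real.arctan a + Real.arctan b := by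
  rw [← Real.arccos_cos (x := Real.arctan a + Real.arctan b), Real.cos_add, Real.cos_arctan,
    Real.cos_arctan, Real.sin_arctan, Real.sin_arctan]
  · congr 1
    ring
  · have : Real.arctan (-b) ≤ Real.arctan a := Real.arctan_mono (by linarith)
    rw [Real.arctan_neg] at this
    linarith
  · linarith [Real.arctan_lt_pi_div_two a, Real.arctan_lt_pi_div_two b, Real.pi_pos]

theorem cosh_sq_mul (x : ℝ) : Real.cosh x ^ 2 * (1 - Real.tanh x ^ 2) = 1 := by
  have := (Real.cosh_pos x).ne'
  rw [Real.tanh_eq_sinh_div_cosh]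
  field_simp
  exact Real.cosh_sq_sub_sinh_sq x

theorem cosh_add_eq (x y : ℝ) :
    Real.cosh (x + y) = Real.cosh x * Real.cosh y * (1 + Real.tanh x * Real.tanh y) := by
  have hx := (Real.cosh_pos x).ne'
  have hy := (Real.cosh_pos y).ne'
  rw [Real.tanh_eq_sinh_div_cosh, Real.tanh_eq_sinh_div_cosh, Real.cosh_add]
  field_simp

theorem tanh_pos {x : ℝ} (hx : 0 < x) : 0 < Real.tanh x := by
  rw [Real.tanh_eq_sinh_div_cosh]
  exact div_pos (Real.sinh_pos_iff.2 hx) (Real.cosh_pos x)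

/-- Vertices of an explicit realization, up to the factor `cosh`. -/
noncomputable def modelFrame : Fin 4 → Fin 4 → ℝ :=
  ![![1, 1, 1, 1], ![1, -1, -1, 1], ![-1, 1, -1, 1], ![-1, -1, 1, 1]]

noncomputable def modelShift (t : Fin 4 → ℝ) : Fin 4 → ℝ :=
  ![(t 0 + t 1 - t 2 - t 3) / 2, (t 0 - t 1 + t 2 - t 3) / 2, (t 0 - t 1 - t 2 + t 3) / 2,
    -(t 0 + t 1 + t 2 + t 3) / 2]

theorem lor_modelFrame (i j : Fin 4) :
    lor (modelFrame i) (modelFrame j) = if i = j then 2 else -2 := by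
  fin_cases i <;> fin_cases j <;> simp [lor, modelFrame] <;> norm_num

theorem lor_modelFrame_shift (t : Fin 4 → ℝ) (i : Fin 4) :
    lor (modelFrame i) (modelShift t) = 2 * t i := by
  fin_cases i <;> simp [lor, modelFrame, modelShift] <;> ring

theorem lor_modelShift (t : Fin 4 → ℝ) :
    lor (modelShift t) (modelShift t) = 2 * (1 - discr t / 4) := by
  simp [lor, modelShift, discr, Fin.sum_univ_four]; ring

theorem lor_smul_add (a b κ p q : ℝ) (x y w : Fin 4 → ℝ) :
    lor (a • (x + (κ * p) • w)) (b • (y + (κ * q) • w)) =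
      a * b * (lor x y + κ * q * lor x w + κ * p * lor y w + κ ^ 2 * p * q * lor w w) := by
  simp only [lor, Pi.add_apply, Pi.smul_apply, smul_eq_mul]; ring

/-- `modelFrame` realizes the Gram matrix at `t = 0` up to scale, and `modelShift t` represents the
functional taking the values `2 * t i` on that frame. Adding multiples of it to the frame vectors
produces the rank-one correction. -/
theorem exists_gram {c t : Fin 4 → ℝ} (hD : 0 < discr t) :
    ∃ v : Fin 4 → Fin 4 → ℝ, ∀ i j, lor (v i) (v j) =
      c i * c j * ((if i = j then 1 else -1) - t i * t j) := by
  -- A root of `(1 - D/4) κ² + 2 κ + 1 = 0` with `D = discr t`; of the two roots this one has a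
  -- denominator that never vanishes.
  set κ : ℝ := -1 / (1 + √(discr t) / 2) with hκ
  have hs := Real.sq_sqrt hD.le
  have hs0 := Real.sqrt_nonneg (discr t)
  have hk : 2 * κ + κ ^ 2 * (1 - discr t / 4) = -1 := by
    rw [hκ]
    generalize √(discr t) = s at hs hs0
    have : 1 + s / 2 ≠ 0 := by positivity
    rw [← hs]
    field_simp
    ring
  refine ⟨fun i => (c i / √2) • (modelFrame i + (κ * t i) • modelShift t), fun i j => ?_⟩
  rw [lor_smul_add, lor_modelFrame, lor_modelFrame_shift, lor_modelFrame_shift, lor_modelShift]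
  have h2 : c i / √2 * (c j / √2) = c i * c j / 2 := by
    rw [div_mul_div_comm, Real.mul_self_sqrt (by norm_num)]
  rw [h2]
  split_ifs <;> linear_combination c i * c j * t i * t j * hk

theorem lor_sum_left (a : Fin 4 → ℝ) (v : Fin 4 → Fin 4 → ℝ) (y : Fin 4 → ℝ) :
    lor (∑ i, a i • v i) y = ∑ i, a i * lor (v i) y := by
  simp [lor, Fin.sum_univ_four]; ring

/-- Pairing a linear relation with each `v j` expresses its coefficients through the two sums `B`
and `Q`. Summing with weights `1` and `t j` gives a 2×2 system whose elimination leaves `discr t * Q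
= 0`. -/
theorem linearIndependent_of_gram {c t : Fin 4 → ℝ} (hc : ∀ i, 0 < c i) (hD : 0 < discr t)
    {v : Fin 4 → Fin 4 → ℝ} (hv : ∀ i j, lor (v i) (v j) =
      c i * c j * ((if i = j then 1 else -1) - t i * t j)) : LinearIndependent ℝ v := by
  rw [Fintype.linearIndependent_iff]
  intro a ha
  have h : ∀ j, 2 * (a j * c j) = ∑ i, a i * c i + t j * ∑ i, t i * (a i * c i) := by
    intro j
    have h0 : ∑ i, a i * lor (v i) (v j) = 0 := by
      rw [← lor_sum_left, ha]; simp [lor]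
    have h1 : ∑ i, a i * lor (v i) (v j) =
        c j * (2 * (a j * c j) - ∑ i, a i * c i - t j * ∑ i, t i * (a i * c i)) := by
      simp only [hv]
      fin_cases j <;> simp [Fin.sum_univ_four] <;> ring
    rw [h1] at h0
    have := (mul_eq_zero.1 h0).resolve_left (hc j).ne'
    linarith
  set B := ∑ i, a i * c i with hB
  set Q := ∑ i, t i * (a i * c i) with hQ
  have e1 : 2 * B = 4 * B + (∑ i, t i) * Q := by
    have : 2 * B = ∑ j, 2 * (a j * c j) := by rw [hB, Finset.mul_sum]
    rw [this, Finset.sum_congr rfl fun j _ => h j]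
    simp [Fin.sum_univ_four]; ring
  have e2 : 2 * Q = (∑ i, t i) * B + (∑ i, t i ^ 2) * Q := by
    have : 2 * Q = ∑ j, t j * (2 * (a j * c j)) := by
      rw [hQ, Finset.mul_sum]; exact Finset.sum_congr rfl fun j _ => by ring
    rw [this, Finset.sum_congr rfl fun j _ => by rw [h j]]
    simp [Fin.sum_univ_four]; ring
  have e3 : discr t * Q = 0 := by
    rw [discr]; linear_combination 2 * e2 - (∑ i, t i) * e1
  have hQ0 : Q = 0 := (mul_eq_zero.1 e3).resolve_left hD.ne'
  rw [hQ0] at e1 h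
  intro i
  have := h i
  have hB0 : B = 0 := by linarith
  rw [hB0] at this
  exact (mul_eq_zero.1 (show a i * c i = 0 by linarith)).resolve_right (hc i).ne'

theorem discr_tanh_pos {ρ : Fin 4 → ℝ} (hρ : ∀ i, 0 < ρ i) : 0 < discr fun i => Real.tanh (ρ i) :=
  discr_pos (fun i => (tanh_pos (hρ i)).le) fun _ => Real.tanh_lt_one _

/-- All positive radii are realized by a non-degenerate hyper-ideal tetrahedron. -/
theorem realizable_add {ρ : Fin 4 → ℝ} (hρ : ∀ i, 0 < ρ i) :
    Realizable fun i j => ρ i + ρ j := by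
  obtain ⟨v, hv⟩ := exists_gram (c := fun i => Real.cosh (ρ i)) (discr_tanh_pos hρ)
  refine ⟨v, fun i => ?_, fun i j _ => add_pos (hρ i) (hρ j), fun i j hij => ?_,
    linearIndependent_of_gram (fun _ => Real.cosh_pos _) (discr_tanh_pos hρ) hv⟩
  · rw [hv, if_pos rfl]
    linear_combination cosh_sq_mul (ρ i)
  · rw [hv, if_neg hij, cosh_add_eq]
    ring

/-- Gram matrix of the components orthogonal to an edge. -/
theorem lor_orthComp_tanh {ρ : Fin 4 → ℝ} (hρ : ∀ i, 0 < ρ i) {v : Fin 4 → Fin 4 → ℝ}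
    (hv : IsHyperidealTetrahedron (fun i j => ρ i + ρ j) v) {i j : Fin 4} (hij : i ≠ j)
    (x y : Fin 4) (hxi : x ≠ i) (hxj : x ≠ j) (hyi : y ≠ i) (hyj : y ≠ j) :
    let t : Fin 4 → ℝ := fun i => Real.tanh (ρ i)
    lor (orthComp (v i) (v j) (v x)) (orthComp (v i) (v j) (v y)) =
      lor (v x) (v y) + Real.cosh (ρ x) * Real.cosh (ρ y) *
        ((1 - t j ^ 2) * (1 + t x * t i) * (1 + t y * t i)
          + (1 - t i ^ 2) * (1 + t x * t j) * (1 + t y * t j)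
          + (1 + t i * t j) * ((1 + t x * t i) * (1 + t y * t j)
              + (1 + t x * t j) * (1 + t y * t i))) / (t i + t j) ^ 2 := by
  intro t
  have hs : 0 < t i + t j := add_pos (tanh_pos (hρ i)) (tanh_pos (hρ j))
  have hi := cosh_sq_mul (ρ i)
  have hj := cosh_sq_mul (ρ j)
  have hci := (Real.cosh_pos (ρ i)).ne'
  have hcj := (Real.cosh_pos (ρ j)).ne'
  have hg : 1 - lor (v i) (v j) ^ 2 =
      -(Real.cosh (ρ i) ^ 2 * Real.cosh (ρ j) ^ 2 * (t i + t j) ^ 2) := by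
    rw [hv.length i j hij, cosh_add_eq]
    simp only [t]
    linear_combination (-(1 : ℝ)) * hi -
      Real.cosh (ρ i) ^ 2 * (1 - Real.tanh (ρ i) ^ 2) * hj
  have hne : 1 - lor (v i) (v j) ^ 2 ≠ 0 := by
    rw [hg]; exact neg_ne_zero.2 (by positivity)
  rw [lor_orthComp (hv.unit i) (hv.unit j) hne, hg, hv.length i j hij, hv.length x i hxi,
    hv.length x j hxj, hv.length y i hyi, hv.length y j hyj]
  simp only [cosh_add_eq]
  have key : (1 - t j ^ 2) = 1 / Real.cosh (ρ j) ^ 2 := by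
    field_simp; linear_combination hj
  have key' : (1 - t i ^ 2) = 1 / Real.cosh (ρ i) ^ 2 := by
    field_simp; linear_combination hi
  rw [key, key']
  simp only [t] at hs ⊢
  field_simp
  ring

/-- If `u`, `w` are the slopes at the two remaining vertices, the projected vectors have squared
lengths proportional to `1 + w²`, `1 + u²` and inner product proportional to `1 - u w`. The cosine
is then that of `arctan u + arctan w`, and `u + w ≥ 0` keeps this sum in the range of `arccos`. -/
theorem dihedral_eq_arctan {ρ : Fin 4 → ℝ} (hρ : ∀ i, 0 < ρ i) {v : Fin 4 → Fin 4 → ℝ}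
    (hv : IsHyperidealTetrahedron (fun i j => ρ i + ρ j) v) {i j : Fin 4} (hij : i ≠ j) :
    dihedral v i j = Real.arctan (slope (fun i => Real.tanh (ρ i)) (other₁ i j)) +
      Real.arctan (slope (fun i => Real.tanh (ρ i)) (other₂ i j)) := by
  obtain ⟨h1, h2, h3, h4, h5⟩ := other_spec i j hij
  have hD := discr_tanh_pos hρ
  have hsum := sum_eq_other hij fun i => Real.tanh (ρ i)
  have hsq := sum_eq_other hij fun i => Real.tanh (ρ i) ^ 2
  have hDk : discr (fun i => Real.tanh (ρ i)) =
      4 + (∑ k, Real.tanh (ρ k)) ^ 2 - 2 * ∑ k, Real.tanh (ρ k) ^ 2 := rfl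
  rw [hsum, hsq] at hDk
  rw [dihedral, lor_orthComp_tanh hρ hv hij _ _ h1 h2 h3 h4,
    lor_orthComp_tanh hρ hv hij _ _ h1 h2 h1 h2, lor_orthComp_tanh hρ hv hij _ _ h3 h4 h3 h4,
    hv.unit, hv.unit, hv.length _ _ h5.ne, cosh_add_eq]
  have hu1 : slope (fun i => Real.tanh (ρ i)) (other₁ i j) = (Real.tanh (ρ i) + Real.tanh (ρ j)
      + (Real.tanh (ρ (other₂ i j)) - Real.tanh (ρ (other₁ i j)))) /
        √(discr fun i => Real.tanh (ρ i)) := by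
    rw [slope, hsum]; congr 1; ring
  have hu2 : slope (fun i => Real.tanh (ρ i)) (other₂ i j) = (Real.tanh (ρ i) + Real.tanh (ρ j)
      - (Real.tanh (ρ (other₂ i j)) - Real.tanh (ρ (other₁ i j)))) /
        √(discr fun i => Real.tanh (ρ i)) := by
    rw [slope, hsum]; congr 1; ring
  have hi := tanh_pos (hρ i)
  have hj := tanh_pos (hρ j)
  have hk := cosh_sq_mul (ρ (other₁ i j))
  have hh := cosh_sq_mul (ρ (other₂ i j))
  have hck := Real.cosh_pos (ρ (other₁ i j))
  have hch := Real.cosh_pos (ρ (other₂ i j))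
  rw [← arccos_slope]
  swap
  · rw [hu1, hu2, ← add_div]
    exact div_nonneg (by linarith) (Real.sqrt_nonneg _)
  rw [hu1, hu2]
  beta_reduce
  set D := discr fun i => Real.tanh (ρ i)
  generalize Real.tanh (ρ i) = a at *
  generalize Real.tanh (ρ j) = b at *
  generalize Real.tanh (ρ (other₁ i j)) = c at *
  generalize Real.tanh (ρ (other₂ i j)) = d at *
  generalize Real.cosh (ρ (other₁ i j)) = p at *
  generalize Real.cosh (ρ (other₂ i j)) = q at *
  have hs : 0 < a + b := by linarith
  have hsD := Real.sq_sqrt hD.le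
  have hsD0 := Real.sqrt_pos.2 hD
  have f1 : p ^ 2 * (1 - c ^ 2) + p * p * ((1 - b ^ 2) * (1 + c * a) * (1 + c * a)
      + (1 - a ^ 2) * (1 + c * b) * (1 + c * b) + (1 + a * b) * ((1 + c * a) * (1 + c * b)
      + (1 + c * b) * (1 + c * a))) / (a + b) ^ 2 =
      (p * √D / (a + b)) ^ 2 * (1 + ((a + b - (d - c)) / √D) ^ 2) := by
    field_simp
    rw [hsD, hDk]
    ring
  have f2 : q ^ 2 * (1 - d ^ 2) + q * q * ((1 - b ^ 2) * (1 + d * a) * (1 + d * a)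
      + (1 - a ^ 2) * (1 + d * b) * (1 + d * b) + (1 + a * b) * ((1 + d * a) * (1 + d * b)
      + (1 + d * b) * (1 + d * a))) / (a + b) ^ 2 =
      (q * √D / (a + b)) ^ 2 * (1 + ((a + b + (d - c)) / √D) ^ 2) := by
    field_simp
    rw [hsD, hDk]
    ring
  have f3 : -(p * q * (1 + c * d)) + p * q * ((1 - b ^ 2) * (1 + c * a) * (1 + d * a)
      + (1 - a ^ 2) * (1 + c * b) * (1 + d * b) + (1 + a * b) * ((1 + c * a) * (1 + d * b)
      + (1 + c * b) * (1 + d * a))) / (a + b) ^ 2 =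
      (p * √D / (a + b)) * (q * √D / (a + b)) *
        (1 - (a + b + (d - c)) / √D * ((a + b - (d - c)) / √D)) := by
    field_simp
    rw [hsD, hDk]
    ring
  rw [hk] at f1
  rw [hh] at f2
  rw [f1, f2, f3, Real.sqrt_mul (by positivity), Real.sqrt_mul (by positivity),
    Real.sqrt_sq (by positivity), Real.sqrt_sq (by positivity)]
  congr 1
  generalize 1 + ((a + b + (d - c)) / √D) ^ 2 = X
  generalize 1 + ((a + b - (d - c)) / √D) ^ 2 = Y
  rw [show p * √D / (a + b) * √Y * (q * √D / (a + b) * √X) =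
    p * √D / (a + b) * (q * √D / (a + b)) * (√X * √Y) by ring]
  rw [mul_div_mul_left _ _ (by positivity)]

theorem angle_eq_arctan {ρ : Fin 4 → ℝ} (hρ : ∀ i, 0 < ρ i) {i j : Fin 4} (hij : i ≠ j) :
    angle (fun i j => ρ i + ρ j) i j =
      Real.arctan (slope (fun i => Real.tanh (ρ i)) (other₁ i j)) +
      Real.arctan (slope (fun i => Real.tanh (ρ i)) (other₂ i j)) := by
  rw [angle, dif_pos (realizable_add hρ)]
  exact dihedral_eq_arctan hρ (realizable_add hρ).choose_spec hij

end HyperIdeal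

/-! ### Continuity argument for definite forms -/

/-- Positive definiteness propagates along a continuous path of non-degenerate symmetric forms. -/
theorem posDef_of_path {E : Type*} [NormedAddCommGroup E] [NormedSpace ℝ E] [ProperSpace E]
    (Q : ℝ → E →ₗ[ℝ] E →ₗ[ℝ] ℝ)
    (hcont : ContinuousOn (fun p : ℝ × E => Q p.1 p.2 p.2) (Icc 0 1 ×ˢ univ))
    (hsymm : ∀ s ∈ Icc (0 : ℝ) 1, ∀ x y, Q s x y = Q s y x)
    (hnd : ∀ s ∈ Icc (0 : ℝ) 1, ∀ x, (∀ y, Q s x y = 0) → x = 0)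
    (h0 : ∀ x, x ≠ 0 → 0 < Q 0 x x) (x : E) (hx : x ≠ 0) : 0 < Q 1 x x := by
  by_contra hneg
  have hscale : ∀ (s : ℝ) (y : E), Q s y y = ‖y‖ ^ 2 * Q s (‖y‖⁻¹ • y) (‖y‖⁻¹ • y) := by
    intro s y
    rcases eq_or_ne y 0 with rfl | hy
    · simp
    · have := norm_ne_zero_iff.2 hy
      simp only [map_smul, LinearMap.smul_apply, smul_eq_mul]
      field_simp
  have hunit : ∀ y : E, y ≠ 0 → ‖y‖⁻¹ • y ∈ Metric.sphere (0 : E) 1 := by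
    intro y hy
    have := norm_ne_zero_iff.2 hy
    simp [norm_smul, this]
  have hsub : Icc (0 : ℝ) 1 ×ˢ Metric.sphere (0 : E) 1 ⊆ Icc 0 1 ×ˢ univ :=
    prod_mono_right (subset_univ _)
  have hK : IsCompact ((Icc (0 : ℝ) 1 ×ˢ Metric.sphere (0 : E) 1) ∩
      (fun p : ℝ × E => Q p.1 p.2 p.2) ⁻¹' Iic 0) := by
    have hc : IsCompact (Icc (0 : ℝ) 1 ×ˢ Metric.sphere (0 : E) 1) :=
      isCompact_Icc.prod (isCompact_sphere 0 1)
    exact hc.of_isClosed_subset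
      ((hcont.mono hsub).preimage_isClosed_of_isClosed hc.isClosed isClosed_Iic) inter_subset_left
  have hne : ((Icc (0 : ℝ) 1 ×ˢ Metric.sphere (0 : E) 1) ∩
      (fun p : ℝ × E => Q p.1 p.2 p.2) ⁻¹' Iic 0).Nonempty := by
    refine ⟨(1, ‖x‖⁻¹ • x), ⟨⟨by simp, hunit x hx⟩, ?_⟩⟩
    rw [hscale, not_lt] at hneg
    have : 0 < ‖x‖ ^ 2 := by positivity
    simp only [mem_preimage, mem_Iic]
    by_contra hpos
    exact absurd hneg (not_le.2 (mul_pos this (not_le.1 hpos)))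
  -- The first parameter at which some unit vector `z` fails to be positive. The form is still
  -- nonnegative there by continuity, so `z` is a null vector and hence lies in the kernel.
  obtain ⟨⟨s, z⟩, ⟨⟨hs, hz⟩, hle⟩, hmin⟩ := hK.exists_isMinOn hne continuous_fst.continuousOn
  simp only [mem_preimage, mem_Iic] at hle hs hz
  have hz0 : z ≠ 0 := by
    rintro rfl; simp at hz
  have hs0 : 0 < s := by
    rcases hs.1.eq_or_lt with h | h
    · rw [← h] at hle; exact absurd hle (not_le.2 (h0 z hz0))
    · exact h
  have hnn : ∀ y, 0 ≤ Q s y y := by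
    intro y
    rcases eq_or_ne y 0 with rfl | hy
    · simp
    have hcl : closure (Ico 0 s) = Icc 0 s := closure_Ico hs0.ne
    have hc : ContinuousOn (fun u : ℝ => Q u (‖y‖⁻¹ • y) (‖y‖⁻¹ • y)) (closure (Ico 0 s)) := by
      rw [hcl]
      exact hcont.comp (f := fun u : ℝ => (u, ‖y‖⁻¹ • y)) (by fun_prop)
        fun u hu => ⟨⟨hu.1, hu.2.trans hs.2⟩, mem_univ _⟩
    rw [hscale]
    refine mul_nonneg (by positivity) (le_on_closure (f := fun _ : ℝ => (0 : ℝ)) ?_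
      continuousOn_const hc (by rw [hcl]; exact ⟨hs0.le, le_rfl⟩))
    intro u hu
    by_contra hlt
    have := hmin (a := (u, ‖y‖⁻¹ • y))
      ⟨⟨⟨hu.1, hu.2.le.trans hs.2⟩, hunit y hy⟩, (not_le.1 hlt).le⟩
    exact absurd this (not_le.2 hu.2)
  refine hz0 (hnd s hs z fun y => ?_)
  have hzz : Q s z z = 0 := le_antisymm hle (hnn z)
  -- Near-optimal perturbation of `z` towards `y`; the `+ 1` in the denominator covers the case `Q s
  -- y y = 0`.
  have hexp := hnn (z + (-(Q s z y) / (Q s y y + 1)) • y)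
  simp only [map_add, map_smul, LinearMap.add_apply, LinearMap.smul_apply, smul_eq_mul, hzz,
    hsymm s hs y z] at hexp
  have hyy := hnn y
  have hpos : 0 < Q s y y + 1 := by linarith
  set b := Q s z y
  set c := Q s y y
  have : -(b ^ 2 * (c + 2) / (c + 1) ^ 2) ≥ 0 := by
    have e : -(b ^ 2 * (c + 2) / (c + 1) ^ 2) =
      0 + -b / (c + 1) * b + (-b / (c + 1)) * (b + -b / (c + 1) * c) := by
        field_simp; ring
    rw [e]; linarith
  have h2 : 0 ≤ b ^ 2 * (c + 2) / (c + 1) ^ 2 := by positivity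
  have h3 : b ^ 2 * (c + 2) / (c + 1) ^ 2 = 0 := by linarith
  rw [div_eq_zero_iff, mul_eq_zero] at h3
  rcases h3 with (h | h) | h
  · exact pow_eq_zero_iff (two_ne_zero) |>.1 h
  · linarith
  · exact absurd h (by positivity)

/-! ### The Jacobian of the vertex angle sums of one tetrahedron -/

namespace HyperIdeal

/-- `√(discr t)` times the derivative of the face angles in the direction `ξ`. -/
noncomputable def faceDeriv (t ξ : Fin 4 → ℝ) (h : Fin 4) : ℝ :=
  (discr t * (∑ k, ξ k - 2 * ξ h) - (∑ k, t k - 2 * t h) * ∑ k, (∑ l, t l - 2 * t k) * ξ k) /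
    (discr t + (∑ k, t k - 2 * t h) ^ 2)

theorem hasDerivAt_arctan_slope {t : ℝ → Fin 4 → ℝ} {ξ : Fin 4 → ℝ} {s : ℝ}
    (ht : ∀ i, HasDerivAt (fun s => t s i) (ξ i) s) (hD : 0 < discr (t s)) (h : Fin 4) :
    HasDerivAt (fun s => Real.arctan (slope (t s) h)) (faceDeriv (t s) ξ h / √(discr (t s))) s := by
  have hsum : HasDerivAt (fun s => ∑ i, t s i) (∑ i, ξ i) s := HasDerivAt.fun_sum fun i _ => ht i
  have hsq : HasDerivAt (fun s => ∑ i, t s i ^ 2) (∑ i, 2 * t s i * ξ i) s :=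
    HasDerivAt.fun_sum fun i _ => by simpa using (ht i).fun_pow 2
  have hdis : HasDerivAt (fun s => discr (t s))
      (2 * (∑ i, t s i) * (∑ i, ξ i) - 2 * ∑ i, 2 * t s i * ξ i) s := by
    simpa [discr] using ((hsum.fun_pow 2).const_add 4).fun_sub (hsq.const_mul 2)
  have hu := hsum.sub ((ht h).const_mul 2)
  have hsl := (hu.div (hdis.sqrt hD.ne') (Real.sqrt_pos.2 hD).ne').arctan
  refine hsl.congr_deriv ?_
  have hr := Real.sqrt_pos.2 hD
  have hr2 := Real.sq_sqrt hD.le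
  have hW : ∑ k, (∑ l, t s l - 2 * t s k) * ξ k =
      (∑ i, t s i) * (∑ i, ξ i) - ∑ i, 2 * t s i * ξ i := by
    simp only [Fin.sum_univ_four]; ring
  simp only [faceDeriv, Pi.sub_apply, Pi.div_apply]
  rw [hW]
  generalize ∑ i, 2 * t s i * ξ i = m
  generalize ∑ i, ξ i = n
  generalize ∑ i, t s i - 2 * t s h = u
  generalize ∑ i, t s i = S
  generalize √(discr (t s)) = r at *
  rw [← hr2]
  have : r ^ 2 + u ^ 2 ≠ 0 := by positivity
  field_simp

/-- The coefficients of `faceDeriv`. -/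
noncomputable def faceCoeff (a b c d : ℝ) : ℝ :=
  (2 - c ^ 2 - d ^ 2 + (c + d) * (a + b)) / (2 * (1 + b * c + b * d + c * d))

/-- Reciprocity of mixed derivatives for a pair of vertices `a`, `b`: each side is, up to a common
factor, the derivative of the angle sum at one of them in the radius of the other. The terms `-1`
come from the face angle whose own vertex is varied. -/
theorem faceCoeff_symm {a b c d : ℝ} (h1 : 1 + a * b + b * d + a * d ≠ 0)
    (h2 : 1 + a * b + b * c + a * c ≠ 0) :
    (1 - b ^ 2) * (-1 + faceCoeff c b a d + faceCoeff d b a c) =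
      (1 - a ^ 2) * (-1 + faceCoeff c a b d + faceCoeff d a b c) := by
  have e1 : 1 + b * a + b * d + a * d ≠ 0 := by convert h1 using 1; ring
  have e2 : 1 + b * a + b * c + a * c ≠ 0 := by convert h2 using 1; ring
  have e3 : 1 + a * b + a * d + b * d ≠ 0 := by convert h1 using 1; ring
  have e4 : 1 + a * b + a * c + b * c ≠ 0 := by convert h2 using 1; ring
  have f1 : faceCoeff c b a d = (2 - a ^ 2 - d ^ 2 + (a + d) * (c + b)) /
    (2 * (1 + a * b + b * d + a * d)) := by rw [faceCoeff]; congr 1; ring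
  have f2 : faceCoeff d b a c = (2 - a ^ 2 - c ^ 2 + (a + c) * (d + b)) /
    (2 * (1 + a * b + b * c + a * c)) := by rw [faceCoeff]; congr 1; ring
  have f3 : faceCoeff c a b d = (2 - b ^ 2 - d ^ 2 + (b + d) * (c + a)) /
    (2 * (1 + a * b + b * d + a * d)) := by rw [faceCoeff]; congr 1; ring
  have f4 : faceCoeff d a b c = (2 - b ^ 2 - c ^ 2 + (b + c) * (d + a)) /
    (2 * (1 + a * b + b * c + a * c)) := by rw [faceCoeff]; congr 1; ring
  rw [f1, f2, f3, f4]
  field_simp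
  ring

/-- The denominator of `faceDeriv` is four times an expression free of `t 0`, and the coefficient of
`ξ 0` in the numerator is exactly minus that denominator. -/
theorem faceDeriv_zero (t ξ : Fin 4 → ℝ) (h : 1 + t 1 * t 2 + t 1 * t 3 + t 2 * t 3 ≠ 0) :
    faceDeriv t ξ 0 = -ξ 0 + faceCoeff (t 0) (t 1) (t 2) (t 3) * ξ 1 +
      faceCoeff (t 0) (t 2) (t 1) (t 3) * ξ 2 + faceCoeff (t 0) (t 3) (t 1) (t 2) * ξ 3 := by
  have h' : 1 + t 2 * t 1 + t 2 * t 3 + t 1 * t 3 = 1 + t 1 * t 2 + t 1 * t 3 + t 2 * t 3 := by ring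
  have h'' : 1 + t 3 * t 1 + t 3 * t 2 + t 1 * t 2 = 1 + t 1 * t 2 + t 1 * t 3 + t 2 * t 3 := by ring
  have hd : discr t + (∑ k, t k - 2 * t 0) ^ 2 =
      4 * (1 + t 1 * t 2 + t 1 * t 3 + t 2 * t 3) := by
    simp only [discr, Fin.sum_univ_four]; ring
  rw [faceDeriv, hd, faceCoeff, faceCoeff, faceCoeff, h', h'', discr]
  simp only [Fin.sum_univ_four]
  field_simp
  ring

/-- Relabelling symmetry, from which the other three face expansions follow by a transposition. -/
theorem faceDeriv_comp_perm (t ξ : Fin 4 → ℝ) (e : Equiv.Perm (Fin 4)) (h : Fin 4) :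
    faceDeriv (t ∘ e) (ξ ∘ e) h = faceDeriv t ξ (e h) := by
  have hs : ∀ f : Fin 4 → ℝ, ∑ k, f (e k) = ∑ k, f k := fun f => Equiv.sum_comp e f
  simp only [faceDeriv, discr, Function.comp_apply, hs, hs fun k => t k ^ 2,
    hs fun k => (∑ l, t l - 2 * t k) * ξ k]

theorem faceDeriv_one (t ξ : Fin 4 → ℝ) (h : 1 + t 0 * t 2 + t 0 * t 3 + t 2 * t 3 ≠ 0) :
    faceDeriv t ξ 1 = -ξ 1 + faceCoeff (t 1) (t 0) (t 2) (t 3) * ξ 0 +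
      faceCoeff (t 1) (t 2) (t 0) (t 3) * ξ 2 + faceCoeff (t 1) (t 3) (t 0) (t 2) * ξ 3 := by
  have := faceDeriv_zero (t ∘ Equiv.swap 0 1) (ξ ∘ Equiv.swap 0 1)
  rw [faceDeriv_comp_perm] at this
  exact this h

theorem faceDeriv_two (t ξ : Fin 4 → ℝ) (h : 1 + t 1 * t 0 + t 1 * t 3 + t 0 * t 3 ≠ 0) :
    faceDeriv t ξ 2 = -ξ 2 + faceCoeff (t 2) (t 1) (t 0) (t 3) * ξ 1 +
      faceCoeff (t 2) (t 0) (t 1) (t 3) * ξ 0 + faceCoeff (t 2) (t 3) (t 1) (t 0) * ξ 3 := by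
  have := faceDeriv_zero (t ∘ Equiv.swap 0 2) (ξ ∘ Equiv.swap 0 2)
  rw [faceDeriv_comp_perm] at this
  exact this h

theorem faceDeriv_three (t ξ : Fin 4 → ℝ) (h : 1 + t 1 * t 2 + t 1 * t 0 + t 2 * t 0 ≠ 0) :
    faceDeriv t ξ 3 = -ξ 3 + faceCoeff (t 3) (t 1) (t 2) (t 0) * ξ 1 +
      faceCoeff (t 3) (t 2) (t 1) (t 0) * ξ 2 + faceCoeff (t 3) (t 0) (t 1) (t 2) * ξ 0 := by
  have := faceDeriv_zero (t ∘ Equiv.swap 0 3) (ξ ∘ Equiv.swap 0 3)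
  rw [faceDeriv_comp_perm] at this
  exact this h

theorem faceCoeff_comm (a b c d : ℝ) : faceCoeff a b d c = faceCoeff a b c d := by
  rw [faceCoeff, faceCoeff]; congr 1 <;> ring

theorem faceDeriv_add (t ξ η : Fin 4 → ℝ) (h : Fin 4) :
    faceDeriv t (ξ + η) h = faceDeriv t ξ h + faceDeriv t η h := by
  simp only [faceDeriv, ← add_div, Fin.sum_univ_four, Pi.add_apply]
  congr 1; ring

theorem faceDeriv_smul (t ξ : Fin 4 → ℝ) (c : ℝ) (h : Fin 4) :
    faceDeriv t (c • ξ) h = c * faceDeriv t ξ h := by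
  simp only [faceDeriv, ← mul_div_assoc, Fin.sum_univ_four, Pi.smul_apply, smul_eq_mul]
  congr 1; ring

/-- The bilinear form of the derivative of the vertex angle sums with respect to the radii, up to a
positive factor. -/
noncomputable def jacobianForm (t : Fin 4 → ℝ) : (Fin 4 → ℝ) →ₗ[ℝ] (Fin 4 → ℝ) →ₗ[ℝ] ℝ :=
  LinearMap.mk₂ ℝ
    (fun x z => ∑ h, faceDeriv t (fun k => (1 - t k ^ 2) * x k) h * (∑ k, z k - z h))
    (fun x y z => by
      rw [← Finset.sum_add_distrib]
      refine Finset.sum_congr rfl fun h _ => ?_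
      rw [← add_mul, ← faceDeriv_add]
      congr 2; ext k; simp only [Pi.add_apply]; ring)
    (fun c x z => by
      rw [smul_eq_mul, Finset.mul_sum]
      refine Finset.sum_congr rfl fun h _ => ?_
      rw [← mul_assoc, ← faceDeriv_smul]
      congr 2; ext k; simp only [Pi.smul_apply, smul_eq_mul]; ring)
    (fun x y z => by
      rw [← Finset.sum_add_distrib]
      refine Finset.sum_congr rfl fun h _ => ?_
      simp only [Pi.add_apply, Finset.sum_add_distrib]; ring)
    (fun c x z => by
      rw [smul_eq_mul, Finset.mul_sum]
      refine Finset.sum_congr rfl fun h _ => ?_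
      simp only [Pi.smul_apply, smul_eq_mul, ← Finset.mul_sum]; ring)

theorem jacobianForm_apply (t x z : Fin 4 → ℝ) : jacobianForm t x z =
    ∑ h, faceDeriv t (fun k => (1 - t k ^ 2) * x k) h * (∑ k, z k - z h) := rfl

theorem jacobianForm_symm {t : Fin 4 → ℝ} (h0 : ∀ i, 0 ≤ t i) (x z : Fin 4 → ℝ) :
    jacobianForm t x z = jacobianForm t z x := by
  have hne : ∀ i j k, 1 + t i * t j + t i * t k + t j * t k ≠ 0 := fun i j k => by
    have := h0 i; have := h0 j; have := h0 k
    positivity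
  have hne' : ∀ i j k, 1 + t i * t j + t j * t k + t i * t k ≠ 0 := fun i j k => by
    have := h0 i; have := h0 j; have := h0 k
    positivity
  have e01 := faceCoeff_symm (c := t 2) (d := t 3) (hne' 0 1 3) (hne' 0 1 2)
  have e02 := faceCoeff_symm (c := t 1) (d := t 3) (hne' 0 2 3) (hne' 0 2 1)
  have e03 := faceCoeff_symm (c := t 1) (d := t 2) (hne' 0 3 2) (hne' 0 3 1)
  have e12 := faceCoeff_symm (c := t 0) (d := t 3) (hne' 1 2 3) (hne' 1 2 0)
  have e13 := faceCoeff_symm (c := t 0) (d := t 2) (hne' 1 3 2) (hne' 1 3 0)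
  have e23 := faceCoeff_symm (c := t 0) (d := t 1) (hne' 2 3 1) (hne' 2 3 0)
  simp only [jacobianForm_apply, Fin.sum_univ_four, faceDeriv_zero _ _ (hne 1 2 3),
    faceDeriv_one _ _ (hne 0 2 3), faceDeriv_two _ _ (hne 1 0 3), faceDeriv_three _ _ (hne 1 2 0)]
  simp only [faceCoeff_comm (t 0) (t 1) (t 2) (t 3), faceCoeff_comm (t 0) (t 2) (t 1) (t 3),
    faceCoeff_comm (t 0) (t 3) (t 1) (t 2), faceCoeff_comm (t 1) (t 0) (t 2) (t 3),
    faceCoeff_comm (t 1) (t 2) (t 0) (t 3), faceCoeff_comm (t 1) (t 3) (t 0) (t 2),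
    faceCoeff_comm (t 2) (t 0) (t 1) (t 3), faceCoeff_comm (t 2) (t 1) (t 0) (t 3),
    faceCoeff_comm (t 2) (t 3) (t 0) (t 1), faceCoeff_comm (t 3) (t 0) (t 1) (t 2),
    faceCoeff_comm (t 3) (t 1) (t 0) (t 2), faceCoeff_comm (t 3) (t 2) (t 0) (t 1)]
    at e01 e02 e03 e12 e13 e23 ⊢
  linear_combination (z 0 * x 1 - x 0 * z 1) * e01 + (z 0 * x 2 - x 0 * z 2) * e02 +
    (z 0 * x 3 - x 0 * z 3) * e03 + (z 1 * x 2 - x 1 * z 2) * e12 +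
    (z 1 * x 3 - x 1 * z 3) * e13 + (z 2 * x 3 - x 2 * z 3) * e23

/-- Testing on basis vectors kills all four face derivatives. Their numerators then give linear
equations for `ξ`; summing these with weights `1` and `∑ t - 2 * t h` and inserting the definition
of `discr` leaves a nonzero multiple of `W`. So `W = 0`, and then `ξ = 0`. -/
theorem jacobianForm_nondegenerate {t : Fin 4 → ℝ} (h0 : ∀ i, 0 ≤ t i) (h1 : ∀ i, t i < 1)
    {x : Fin 4 → ℝ} (hx : ∀ z, jacobianForm t x z = 0) : x = 0 := by
  have hD := discr_pos h0 h1
  set ξ : Fin 4 → ℝ := fun k => (1 - t k ^ 2) * x k with hξ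
  have hf : ∀ h, faceDeriv t ξ h = 0 := by
    have e : ∀ i, ∑ h, faceDeriv t ξ h - faceDeriv t ξ i = 0 := by
      intro i
      rw [← hx (Pi.single i 1), jacobianForm_apply]
      fin_cases i <;> simp [Fin.sum_univ_four, Pi.single_apply] <;> ring
    have e0 := e 0
    have e1 := e 1
    have e2 := e 2
    have e3 := e 3
    simp only [Fin.sum_univ_four] at e0 e1 e2 e3
    intro h
    fin_cases h <;> simp <;> linarith
  set W := ∑ k, (∑ l, t l - 2 * t k) * ξ k with hW
  have hlin : ∀ h, discr t * (∑ k, ξ k - 2 * ξ h) = (∑ k, t k - 2 * t h) * W := by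
    intro h
    have := hf h
    rw [faceDeriv, div_eq_zero_iff] at this
    rcases this with h | h
    · linarith
    · exact absurd h (by positivity)
  have s1 : discr t * (∑ k, ξ k) = (∑ k, t k) * W := by
    have e0 := hlin 0
    have e1 := hlin 1
    have e2 := hlin 2
    have e3 := hlin 3
    simp only [Fin.sum_univ_four] at e0 e1 e2 e3 ⊢
    linarith
  have s2 : discr t * ((∑ k, t k) * (∑ k, ξ k) - W) = 2 * (∑ k, t k ^ 2) * W := by
    have e : discr t * (2 * (∑ k, t k) * (∑ k, ξ k) - 2 * W) = 4 * (∑ k, t k ^ 2) * W := by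
      have : ∑ h, (∑ k, t k - 2 * t h) * (discr t * (∑ k, ξ k - 2 * ξ h)) =
          ∑ h, (∑ k, t k - 2 * t h) * ((∑ k, t k - 2 * t h) * W) :=
        Finset.sum_congr rfl fun h _ => by rw [hlin]
      have l : ∑ h, (∑ k, t k - 2 * t h) * (discr t * (∑ k, ξ k - 2 * ξ h)) =
          discr t * (2 * (∑ k, t k) * (∑ k, ξ k) - 2 * W) := by
        rw [hW]; simp only [Fin.sum_univ_four]; ring
      have r : ∑ h, (∑ k, t k - 2 * t h) * ((∑ k, t k - 2 * t h) * W) =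
          4 * (∑ k, t k ^ 2) * W := by
        generalize W = w
        simp only [Fin.sum_univ_four]; ring
      rw [← l, this, r]
    linarith
  have hW0 : W = 0 := by
    have : discr t = 4 + (∑ i, t i) ^ 2 - 2 * ∑ i, t i ^ 2 := rfl
    linear_combination (1 / 4 : ℝ) * (-W * this - s2 + (∑ k, t k) * s1)
  have hX : ∑ k, ξ k = 0 := by
    rw [hW0, mul_zero] at s1
    exact (mul_eq_zero.1 s1).resolve_left hD.ne'
  ext i
  have := hlin i
  rw [hW0, mul_zero, hX] at this
  have h2 := (mul_eq_zero.1 this).resolve_left hD.ne'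
  have h3 : (1 - t i ^ 2) * x i = 0 := by
    have : ξ i = 0 := by linarith
    exact this
  have h4 : 0 < 1 - t i ^ 2 := by nlinarith [h0 i, h1 i]
  exact (mul_eq_zero.1 h3).resolve_left h4.ne'

theorem jacobianForm_pos {t : Fin 4 → ℝ} (h0 : ∀ i, 0 ≤ t i) (h1 : ∀ i, t i < 1)
    {x : Fin 4 → ℝ} (hx : x ≠ 0) : 0 < jacobianForm t x x := by
  have hs0 : ∀ s ∈ Icc (0 : ℝ) 1, ∀ i, 0 ≤ (s • t) i := fun s hs i => mul_nonneg hs.1 (h0 i)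
  have hs1 : ∀ s ∈ Icc (0 : ℝ) 1, ∀ i, (s • t) i < 1 := fun s hs i =>
    lt_of_le_of_lt (mul_le_of_le_one_left (h0 i) hs.2) (h1 i)
  -- The path shrinks `t` to `0`, where the form is `2 ∑ y i ^ 2 + (∑ y i) ^ 2`.
  have := posDef_of_path (fun s => jacobianForm (s • t)) ?_
    (fun s hs x y => jacobianForm_symm (hs0 s hs) x y)
    (fun s hs x h => jacobianForm_nondegenerate (hs0 s hs) (hs1 s hs) h) ?_ x hx
  · simpa using this
  · simp only [jacobianForm_apply, faceDeriv, discr]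
    refine continuousOn_finsetSum _ fun h _ => ContinuousOn.mul
      (ContinuousOn.div (by fun_prop) (by fun_prop) ?_) (by fun_prop)
    rintro ⟨s, y⟩ ⟨hs, -⟩
    have := discr_pos (hs0 s hs) (hs1 s hs)
    rw [discr] at this
    positivity
  · intro y hy
    have : jacobianForm ((0 : ℝ) • t) y y = 2 * ∑ i, y i ^ 2 + (∑ i, y i) ^ 2 := by
      simp only [zero_smul, jacobianForm_apply, faceDeriv, discr, Pi.zero_apply, Fin.sum_univ_four]
      ring
    rw [this]
    obtain ⟨i, hi⟩ := Function.ne_iff.1 hy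
    have : 0 < ∑ i, y i ^ 2 :=
      Finset.sum_pos' (fun i _ => sq_nonneg _) ⟨i, Finset.mem_univ _, by
        have : y i ≠ 0 := hi
        positivity⟩
    positivity

/-- The sum of the dihedral angles at the edges through the vertex `i`, as a function of the
radii. -/
noncomputable def vertexAngle (ρ : Fin 4 → ℝ) (i : Fin 4) : ℝ :=
  2 * (∑ h, Real.arctan (slope (fun k => Real.tanh (ρ k)) h) -
    Real.arctan (slope (fun k => Real.tanh (ρ k)) i))

/-- Each face angle with `h ≠ i` belongs to exactly two of the three edges at `i`. -/
theorem sum_angle {ρ : Fin 4 → ℝ} (hρ : ∀ i, 0 < ρ i) (i : Fin 4) :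
    ∑ j with i ≠ j, angle (fun i j => ρ i + ρ j) i j = vertexAngle ρ i := by
  have : ∑ j with i ≠ j, angle (fun i j => ρ i + ρ j) i j = ∑ j with i ≠ j,
      (Real.arctan (slope (fun i => Real.tanh (ρ i)) (other₁ i j)) +
      Real.arctan (slope (fun i => Real.tanh (ρ i)) (other₂ i j))) :=
    Finset.sum_congr rfl fun j hj => angle_eq_arctan hρ (Finset.mem_filter.1 hj).2
  rw [this, vertexAngle, Finset.sum_filter]
  fin_cases i <;> simp [Fin.sum_univ_four, other₁, other₂] <;> ring

theorem hasDerivAt_tanh (x : ℝ) : HasDerivAt Real.tanh (1 - Real.tanh x ^ 2) x := by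
  have h := (Real.hasDerivAt_sinh x).div (Real.hasDerivAt_cosh x) (Real.cosh_pos x).ne'
  have e : Real.sinh / Real.cosh = Real.tanh := by
    ext y; rw [Pi.div_apply, Real.tanh_eq_sinh_div_cosh]
  rw [e] at h
  refine h.congr_deriv ?_
  have := (Real.cosh_pos x).ne'
  rw [Real.tanh_eq_sinh_div_cosh]
  field_simp

theorem contDiff_tanh {n : WithTop ℕ∞} : ContDiff ℝ n Real.tanh := by
  have e : Real.tanh = fun x => Real.sinh x / Real.cosh x := by
    ext y; rw [Real.tanh_eq_sinh_div_cosh]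
  rw [e]
  exact Real.contDiff_sinh.div Real.contDiff_cosh fun x => (Real.cosh_pos x).ne'

theorem contDiffAt_vertexAngle {n : WithTop ℕ∞} {ρ : Fin 4 → ℝ} (hρ : ∀ i, 0 < ρ i) (i : Fin 4) :
    ContDiffAt ℝ n (fun ρ => vertexAngle ρ i) ρ := by
  have ht : ∀ k, ContDiffAt ℝ n (fun ρ : Fin 4 → ℝ => Real.tanh (ρ k)) ρ := fun k =>
    (contDiff_tanh.comp (contDiff_apply ℝ ℝ k)).contDiffAt
  have hs : ∀ h, ContDiffAt ℝ n
      (fun ρ : Fin 4 → ℝ => Real.arctan (slope (fun k => Real.tanh (ρ k)) h)) ρ := by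
    intro h
    have hD := discr_tanh_pos hρ
    have hdis : ContDiffAt ℝ n (fun ρ : Fin 4 → ℝ => discr fun k => Real.tanh (ρ k)) ρ := by
      unfold discr
      exact (contDiffAt_const.add ((ContDiffAt.sum fun k _ => ht k).pow 2)).sub
        (contDiffAt_const.mul (ContDiffAt.sum fun k _ => (ht k).pow 2))
    refine Real.contDiff_arctan.contDiffAt.comp ρ ?_
    unfold slope
    exact (((ContDiffAt.sum fun k _ => ht k)).sub (contDiffAt_const.mul (ht h))).div
      (hdis.sqrt hD.ne') (Real.sqrt_pos.2 hD).ne'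
  unfold vertexAngle
  exact contDiffAt_const.mul ((ContDiffAt.sum fun k _ => hs k).sub (hs i))

/-- The derivative of the vertex angle sums, paired with `z`. -/
theorem hasDerivAt_sum_vertexAngle {ρ : Fin 4 → ℝ} (hρ : ∀ i, 0 < ρ i) (x z : Fin 4 → ℝ) :
    HasDerivAt (fun s : ℝ => ∑ i, z i * vertexAngle (ρ + s • x) i)
      (2 / √(discr fun k => Real.tanh (ρ k)) * jacobianForm (fun k => Real.tanh (ρ k)) x z) 0 := by
  have ht : ∀ k, HasDerivAt (fun s : ℝ => Real.tanh ((ρ + s • x) k))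
      ((1 - Real.tanh (ρ k) ^ 2) * x k) 0 := by
    intro k
    have h1 : HasDerivAt (fun s : ℝ => (ρ + s • x) k) (x k) 0 := by
      simpa using ((hasDerivAt_id (0 : ℝ)).mul_const (x k)).const_add (ρ k)
    have h2 : HasDerivAt Real.tanh (1 - Real.tanh (ρ k) ^ 2) ((ρ + (0 : ℝ) • x) k) := by
      simpa using hasDerivAt_tanh (ρ k)
    exact h2.comp 0 h1
  have h0 : (fun k => Real.tanh ((ρ + (0 : ℝ) • x) k)) = fun k => Real.tanh (ρ k) := by simp
  have hD := discr_tanh_pos hρ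
  have hf := hasDerivAt_arctan_slope (t := fun s k => Real.tanh ((ρ + s • x) k)) ht
    (by rw [h0]; exact hD)
  rw [h0] at hf
  have hv : ∀ i, HasDerivAt (fun s : ℝ => vertexAngle (ρ + s • x) i) _ 0 := fun i =>
    ((HasDerivAt.fun_sum fun h (_ : h ∈ Finset.univ) => hf h).fun_sub (hf i)).const_mul 2
  refine (HasDerivAt.fun_sum fun i (_ : i ∈ Finset.univ) => (hv i).const_mul (z i)).congr_deriv ?_
  rw [jacobianForm_apply]
  simp only [Fin.sum_univ_four]
  field_simp
  ring

end HyperIdeal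

/-! ### Scalar curvature as a smooth function with negative definite derivative -/

theorem sum_sum_fiber {α β M : Type*} [Fintype α] [Fintype β] [DecidableEq β] [AddCommMonoid M]
    (p : α → β) (q : β → Prop) [DecidablePred q] (f : α → M) :
    ∑ e with q e, ∑ a with p a = e, f a = ∑ a, if q (p a) then f a else 0 := by
  rw [← Finset.sum_filter, Finset.sum_comm' (t' := Finset.univ.filter fun a => q (p a))
    (s' := fun a => {p a})]
  · simp
  · intro e a
    simp only [Finset.mem_filter, Finset.mem_univ, true_and, Finset.mem_singleton]
    exact ⟨fun ⟨h1, h2⟩ => ⟨h2.symm, h2 ▸ h1⟩, fun ⟨h1, h2⟩ => ⟨h1 ▸ h2, h1.symm⟩⟩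

namespace FacePairing

open HyperIdeal

variable {T : Type*} (G : FacePairing T)

/-- The class of a vertex of a tetrahedron. -/
def vertexClass (a : T × Fin 4) : G.Vertex := Quot.mk _ a

/-- The class of an oriented edge of a tetrahedron. -/
def edgeClass (a : OEdge T) : G.OrientedEdge := Quot.mk _ a

/-- The radii at the four vertices of a tetrahedron. -/
def radii (r : G.Vertex → ℝ) (σ : T) (i : Fin 4) : ℝ := r (G.vertexClass (σ, i))

/-- Realizability is automatic by `realizable_add`; openness and convexity of the space of metrics
follow. -/
theorem isMetric_iff {r : G.Vertex → ℝ} : G.IsMetric r ↔ ∀ i, 0 < r i :=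
  ⟨fun h => h.1, fun h => ⟨h, fun _ => realizable_add fun _ => h _⟩⟩

theorem isOpen_isMetric [Finite T] : IsOpen {r : G.Vertex → ℝ | G.IsMetric r} := by
  simp only [isMetric_iff, ofPred_forall]
  exact isOpen_iInter_of_finite fun i => isOpen_lt continuous_const (continuous_apply i)

theorem convex_isMetric : Convex ℝ {r : G.Vertex → ℝ | G.IsMetric r} := by
  simp only [isMetric_iff, ofPred_forall]
  exact convex_iInter fun i => convex_halfSpace_gt (LinearMap.proj (R := ℝ) i).isLinear 0

variable [Fintype T]

open Classical in
/-- Regrouping the scalar curvature by vertices of tetrahedra. -/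
theorem exists_scalarCurvature_eq : ∃ c : G.Vertex → ℝ, ∀ r, G.IsMetric r → ∀ i,
    G.scalarCurvature r i = c i - ∑ σ : T, ∑ j : Fin 4,
      if G.vertexClass (σ, j) = i then vertexAngle (G.radii r σ) j else 0 := by
  refine ⟨fun i => ∑ _e : G.OrientedEdge with OrientedEdge.source G _e = i, 2 * Real.pi,
    fun r hr i => ?_⟩
  rw [scalarCurvature]
  simp only [ricciCurvature, Finset.sum_sub_distrib]
  congr 1
  have h1 : ∑ e : G.OrientedEdge with OrientedEdge.source G e = i,
      ∑ a : OEdge T with G.edgeClass a = e,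
        angle (G.length r a.1.1) a.1.2.1 a.1.2.2 =
      ∑ a : OEdge T, if G.vertexClass (a.1.1, a.1.2.1) = i then
        angle (G.length r a.1.1) a.1.2.1 a.1.2.2 else 0 :=
    sum_sum_fiber G.edgeClass
      (fun e => OrientedEdge.source G e = i) _
  refine h1.trans ?_
  rw [← Finset.sum_subtype (Finset.univ.filter fun c : T × Fin 4 × Fin 4 => c.2.1 ≠ c.2.2)
    (by simp) (fun c : T × Fin 4 × Fin 4 => if G.vertexClass (c.1, c.2.1) = i then
        angle (G.length r c.1) c.2.1 c.2.2 else 0)]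
  rw [Finset.sum_filter, Fintype.sum_prod_type]
  refine Finset.sum_congr rfl fun σ _ => ?_
  rw [Fintype.sum_prod_type]
  refine Finset.sum_congr rfl fun j _ => ?_
  split_ifs with h
  · rw [← sum_angle (ρ := G.radii r σ) (fun k => G.isMetric_iff.1 hr _), Finset.sum_filter]
    rfl
  · simp

theorem eventually_isMetric {r : G.Vertex → ℝ} (hr : G.IsMetric r) : ∀ᶠ x in 𝓝 r, G.IsMetric x :=
  have := Finite.of_fintype T
  G.isOpen_isMetric.mem_nhds hr

/-- The explicit angle formula holds only on metrics, but these form an open set, so it determines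
the germ at `r`. -/
theorem contDiffAt_scalarCurvature {n : WithTop ℕ∞} {r : G.Vertex → ℝ} (hr : G.IsMetric r) :
    ContDiffAt ℝ n G.scalarCurvature r := by
  classical
  obtain ⟨c, hc⟩ := G.exists_scalarCurvature_eq
  refine contDiffAt_pi.2 fun i => ?_
  have he : (fun x => G.scalarCurvature x i) =ᶠ[𝓝 r] fun x => c i - ∑ σ : T, ∑ j : Fin 4,
      if G.vertexClass (σ, j) = i then vertexAngle (G.radii x σ) j else 0 :=
    (G.eventually_isMetric hr).mono fun x hx => hc x hx i
  refine ContDiffAt.congr_of_eventuallyEq ?_ he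
  refine contDiffAt_const.sub (ContDiffAt.sum fun σ _ => ContDiffAt.sum fun j _ => ?_)
  split_ifs
  · have hlin : ContDiff ℝ n fun x : G.Vertex → ℝ => G.radii x σ :=
      contDiff_pi.2 fun k => contDiff_apply ℝ ℝ _
    exact ContDiffAt.comp (g := fun ρ => vertexAngle ρ j) r
      (contDiffAt_vertexAngle (ρ := G.radii r σ) (fun k => hr.1 _) j) hlin.contDiffAt
  · exact contDiffAt_const

/-- The bilinear form `-z ⬝ᵥ (DK x)` at the metric `r`. -/
noncomputable def hessianForm (r x z : G.Vertex → ℝ) : ℝ :=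
  ∑ σ : T, 2 / √(discr fun k => Real.tanh (G.radii r σ k)) *
    jacobianForm (fun k => Real.tanh (G.radii r σ k)) (G.radii x σ) (G.radii z σ)

theorem hessianForm_symm {r : G.Vertex → ℝ} (hr : G.IsMetric r) (x z : G.Vertex → ℝ) :
    G.hessianForm r x z = G.hessianForm r z x :=
  Finset.sum_congr rfl fun σ _ => by
    rw [jacobianForm_symm fun i => (tanh_pos (x := G.radii r σ i) (hr.1 _)).le]

theorem hessianForm_pos {r : G.Vertex → ℝ} (hr : G.IsMetric r) {x : G.Vertex → ℝ} (hx : x ≠ 0) :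
    0 < G.hessianForm r x x := by
  have hpos : ∀ σ, G.radii x σ ≠ 0 → 0 < 2 / √(discr fun k => Real.tanh (G.radii r σ k)) *
      jacobianForm (fun k => Real.tanh (G.radii r σ k)) (G.radii x σ) (G.radii x σ) := by
    intro σ hσ
    have := Real.sqrt_pos.2 (discr_tanh_pos (ρ := G.radii r σ) fun k => hr.1 _)
    exact mul_pos (by positivity) (jacobianForm_pos
      (fun k => (tanh_pos (hr.1 _)).le) (fun k => Real.tanh_lt_one _) hσ)
  obtain ⟨i, hi⟩ := Function.ne_iff.1 hx
  -- Every vertex class is represented in some tetrahedron, so a nonzero `x` is nonzero on one of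
  -- them, and that summand is strictly positive.
  obtain ⟨⟨σ, j⟩, rfl⟩ := Quot.exists_rep i
  refine Finset.sum_pos' (fun τ _ => ?_) ⟨σ, Finset.mem_univ _, hpos σ fun h => hi (congrFun h j)⟩
  rcases eq_or_ne (G.radii x τ) 0 with h | h
  · simp [h]
  · exact (hpos τ h).le

theorem dotProduct_fderiv_scalarCurvature {r : G.Vertex → ℝ} (hr : G.IsMetric r)
    (x z : G.Vertex → ℝ) :
    z ⬝ᵥ fderiv ℝ G.scalarCurvature r x = -G.hessianForm r x z := by
  classical
  obtain ⟨c, hc⟩ := G.exists_scalarCurvature_eq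
  have hline : HasDerivAt (fun s : ℝ => r + s • x) x 0 := by
    simpa using ((hasDerivAt_id (0 : ℝ)).smul_const x).const_add r
  have hline0 : r + (0 : ℝ) • x = r := by simp
  have hK : HasDerivAt (fun s : ℝ => G.scalarCurvature (r + s • x))
      (fderiv ℝ G.scalarCurvature r x) 0 := by
    have hd := ((G.contDiffAt_scalarCurvature (n := 1) hr).differentiableAt one_ne_zero).hasFDerivAt
    rw [← hline0] at hd
    have := hd.comp_hasDerivAt (0 : ℝ) hline
    rwa [hline0] at this
  have h1 : HasDerivAt (fun s : ℝ => z ⬝ᵥ G.scalarCurvature (r + s • x))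
      (z ⬝ᵥ fderiv ℝ G.scalarCurvature r x) 0 :=
    HasDerivAt.fun_sum fun i _ => ((hasDerivAt_pi.1 hK i).const_mul (z i))
  have h2 : HasDerivAt (fun s : ℝ => z ⬝ᵥ c - ∑ σ : T, ∑ j : Fin 4,
      G.radii z σ j * vertexAngle (G.radii r σ + s • G.radii x σ) j)
      (-G.hessianForm r x z) 0 := by
    rw [← zero_sub]
    exact (hasDerivAt_const _ _).fun_sub (HasDerivAt.fun_sum fun σ _ =>
      hasDerivAt_sum_vertexAngle (fun k => hr.1 _) _ _)
  have he : (fun s : ℝ => z ⬝ᵥ G.scalarCurvature (r + s • x)) =ᶠ[𝓝 0]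
      fun s : ℝ => z ⬝ᵥ c - ∑ σ : T, ∑ j : Fin 4,
        G.radii z σ j * vertexAngle (G.radii r σ + s • G.radii x σ) j := by
    have : ∀ᶠ s : ℝ in 𝓝 0, G.IsMetric (r + s • x) := by
      refine hline.continuousAt.eventually ?_
      simp only [hline0]
      exact G.eventually_isMetric hr
    refine this.mono fun s hs => ?_
    simp only [dotProduct, hc _ hs, mul_sub, Finset.sum_sub_distrib]
    congr 1
    simp only [Finset.mul_sum]
    rw [Finset.sum_comm]
    refine Finset.sum_congr rfl fun σ _ => ?_
    rw [Finset.sum_comm]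
    refine Finset.sum_congr rfl fun j _ => ?_
    simp only [mul_ite, mul_zero]
    rw [Finset.sum_ite_eq]
    simp only [Finset.mem_univ, if_true]
    rfl
  exact h1.unique (h2.congr_of_eventuallyEq he)

/-- The Laplacian is defined by one-variable derivatives; differentiability of `K` identifies it
with the total derivative. -/
theorem laplacian_mulVec {r : G.Vertex → ℝ} (hr : G.IsMetric r) (y : G.Vertex → ℝ) :
    (G.laplacian r).mulVec y = fderiv ℝ G.scalarCurvature r y := by
  classical
  have hd := ((G.contDiffAt_scalarCurvature (n := 1) hr).differentiableAt one_ne_zero).hasFDerivAt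
  have hentry : ∀ i j, G.laplacian r i j =
      fderiv ℝ G.scalarCurvature r (Pi.single j 1) i := by
    intro i j
    have hu := hasDerivAt_update (𝕜 := ℝ) r j (r j)
    have hd' := hd
    rw [← Function.update_eq_self j r] at hd'
    have := hasDerivAt_pi.1 (hd'.comp_hasDerivAt (r j) hu) i
    rw [Function.update_eq_self] at this
    rw [laplacian, Matrix.of_apply]
    exact this.deriv
  ext i
  conv_rhs => rw [pi_eq_sum_univ' y]
  simp only [Matrix.mulVec, dotProduct, map_sum, map_smul, Finset.sum_apply, Pi.smul_apply,
    smul_eq_mul, hentry]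
  exact Finset.sum_congr rfl fun j _ => mul_comm _ _

end FacePairing

/-! ### Uniqueness, global existence and limits for autonomous equations -/

open scoped NNReal

theorem HasDerivWithinAt.Ici_of_Ico {E : Type*} [NormedAddCommGroup E] [NormedSpace ℝ E]
    {q : ℝ → E} {q' : E} {a b t : ℝ} (ht : t ∈ Ico a b) (h : HasDerivWithinAt q q' (Ico a b) t) :
    HasDerivWithinAt q q' (Ici t) t :=
  h.mono_of_mem_nhdsWithin (mem_of_superset (Ico_mem_nhdsGE ht.2) (Ico_subset_Ico_left ht.1))

/-- Uniqueness for an autonomous equation whose right-hand side is locally Lipschitz. -/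
theorem LocallyLipschitzOn.eqOn_of_hasDerivWithinAt {E : Type*} [NormedAddCommGroup E]
    [NormedSpace ℝ E] {Ω : Set E} {F : E → E} (hF : LocallyLipschitzOn Ω F) {q r : ℝ → E} {S : ℝ}
    (hq : ∀ t ∈ Ico 0 S, q t ∈ Ω ∧ HasDerivWithinAt q (F (q t)) (Ico 0 S) t)
    (hr : ∀ t ∈ Ico 0 S, r t ∈ Ω ∧ HasDerivWithinAt r (F (r t)) (Ico 0 S) t)
    (h0 : q 0 = r 0) : EqOn q r (Ico 0 S) := by
  intro t ht
  have hsub : Icc 0 t ⊆ Ico 0 S := fun s hs => ⟨hs.1, hs.2.trans_lt ht.2⟩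
  have hqc : ContinuousOn q (Icc 0 t) := fun s hs =>
    (hq s (hsub hs)).2.continuousWithinAt.mono hsub
  have hrc : ContinuousOn r (Icc 0 t) := fun s hs =>
    (hr s (hsub hs)).2.continuousWithinAt.mono hsub
  have hK : IsCompact (q '' Icc 0 t ∪ r '' Icc 0 t) :=
    (isCompact_Icc.image_of_continuousOn hqc).union (isCompact_Icc.image_of_continuousOn hrc)
  have hKΩ : q '' Icc 0 t ∪ r '' Icc 0 t ⊆ Ω := by
    rintro _ (⟨s, hs, rfl⟩ | ⟨s, hs, rfl⟩)
    · exact (hq s (hsub hs)).1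
    · exact (hr s (hsub hs)).1
  obtain ⟨L, hL⟩ := (hF.mono hKΩ).exists_lipschitzOnWith_of_compact hK
  exact ODE_solution_unique_of_mem_Icc_right (v := fun _ => F) (fun _ _ => hL) hqc
    (fun s hs => ((hq s (hsub ⟨hs.1, hs.2.le⟩)).2.Ici_of_Ico (hsub ⟨hs.1, hs.2.le⟩)))
    (fun s hs => Or.inl ⟨s, ⟨hs.1, hs.2.le⟩, rfl⟩) hrc
    (fun s hs => ((hr s (hsub ⟨hs.1, hs.2.le⟩)).2.Ici_of_Ico (hsub ⟨hs.1, hs.2.le⟩)))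
    (fun s hs => Or.inr ⟨s, ⟨hs.1, hs.2.le⟩, rfl⟩) h0 ⟨ht.1, le_rfl⟩

/-- Global existence for a bounded Lipschitz vector field. -/
theorem LipschitzWith.exists_hasDerivWithinAt_Ici {E : Type*} [NormedAddCommGroup E]
    [NormedSpace ℝ E] [CompleteSpace E] {F : E → E} {K L : ℝ≥0} (hF : LipschitzWith K F)
    (hL : ∀ x, ‖F x‖ ≤ L) (x₀ : E) :
    ∃ r : ℝ → E, r 0 = x₀ ∧ ∀ t ≥ 0, HasDerivWithinAt r (F (r t)) (Ici 0) t := by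
  have hex : ∀ n : ℕ, ∃ α : ℝ → E, α 0 = x₀ ∧
      ∀ t ∈ Icc (0 : ℝ) n, HasDerivWithinAt α (F (α t)) (Icc (0 : ℝ) n) t := by
    intro n
    -- Since `F` is bounded by `L` everywhere, the ball of radius `L * n` is large enough for the
    -- whole interval `[0, n]`.
    have hpl : IsPicardLindelof (fun _ => F) (tmin := 0) (tmax := n) ⟨0, by simp⟩ x₀
        (L * n) 0 L K :=
      IsPicardLindelof.of_time_independent (fun x _ => hL x) hF.lipschitzOnWith (by simp)
    exact hpl.exists_eq_forall_mem_Icc_hasDerivWithinAt₀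
  choose α hα0 hα using hex
  have hagree : ∀ m n : ℕ, ∀ t : ℝ, 0 ≤ t → t < m → t < n → α m t = α n t := by
    intro m n t ht hm hn
    refine (hF.locallyLipschitz.locallyLipschitzOn (s := univ)).eqOn_of_hasDerivWithinAt
      (S := min m n) (fun s hs => ⟨mem_univ _, ?_⟩) (fun s hs => ⟨mem_univ _, ?_⟩)
      ((hα0 m).trans (hα0 n).symm) ⟨ht, lt_min hm hn⟩
    · exact (hα m s ⟨hs.1, (hs.2.trans_le (min_le_left _ _)).le⟩).mono
        fun u hu => ⟨hu.1, (hu.2.trans_le (min_le_left _ _)).le⟩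
    · exact (hα n s ⟨hs.1, (hs.2.trans_le (min_le_right _ _)).le⟩).mono
        fun u hu => ⟨hu.1, (hu.2.trans_le (min_le_right _ _)).le⟩
  -- The solutions on `[0, n]` are glued by using index `⌊t⌋₊ + 1` at time `t`, so that `t` lies
  -- strictly inside the interval and a two-sided overlap is available for `t > 0`.
  refine ⟨fun t => α (⌊t⌋₊ + 1) t, by simp [hα0], fun t ht => ?_⟩
  have hlt : ∀ s : ℝ, s < ((⌊s⌋₊ + 1 : ℕ) : ℝ) := fun s => by
    push_cast; exact Nat.lt_floor_add_one s
  have heq : ∀ s ∈ Ico (0 : ℝ) ((⌊t⌋₊ + 1 : ℕ) : ℝ), α (⌊s⌋₊ + 1) s = α (⌊t⌋₊ + 1) s :=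
    fun s hs => hagree _ _ s hs.1 (hlt s) hs.2
  have hmem : t ∈ Ico (0 : ℝ) ((⌊t⌋₊ + 1 : ℕ) : ℝ) := ⟨ht, hlt t⟩
  have h1 := ((hα (⌊t⌋₊ + 1) t ⟨ht, (hlt t).le⟩).mono Ico_subset_Icc_self).congr heq (heq t hmem)
  refine h1.mono_of_mem_nhdsWithin ?_
  rw [← Ici_inter_Iio]
  exact inter_mem_nhdsWithin _ (Iio_mem_nhds hmem.2)

/-- The limit of a trajectory is an equilibrium. -/
theorem eq_zero_of_tendsto_of_hasDerivWithinAt {V : Type*} {F : (V → ℝ) → V → ℝ} {r : ℝ → V → ℝ}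
    {p : V → ℝ} (hF : ContinuousAt F p) (hr : ∀ t ≥ 0, HasDerivWithinAt r (F (r t)) (Ici 0) t)
    (hlim : Tendsto r atTop (𝓝 p)) : F p = 0 := by
  ext i
  have hri : ∀ t ≥ 0, HasDerivWithinAt (fun t => r t i) (F (r t) i) (Ici 0) t := fun t ht =>
    hasDerivWithinAt_pi.1 (hr t ht) i
  -- By the mean value theorem the `i`-th component of `F`, at some time in `(n, n + 1)`, equals an
  -- increment that tends to `0`.
  have hmv : ∀ n : ℕ, ∃ c ∈ Ioo (n : ℝ) (n + 1), F (r c) i = r (n + 1) i - r n i := by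
    intro n
    have hn : (0 : ℝ) ≤ n := n.cast_nonneg
    obtain ⟨c, hc, h⟩ := exists_hasDerivAt_eq_slope (fun t => r t i) (fun t => F (r t) i)
      (lt_add_one (n : ℝ))
      (fun t ht => (hri t (hn.trans ht.1)).continuousWithinAt.mono
        fun s hs => hn.trans hs.1)
      (fun t ht => (hri t (hn.trans ht.1.le)).hasDerivAt (Ici_mem_nhds (hn.trans_lt ht.1)))
    exact ⟨c, hc, by simpa using h⟩
  choose c hc hval using hmv
  have hctop : Tendsto c atTop atTop :=
    tendsto_atTop_mono (fun n => (hc n).1.le) tendsto_natCast_atTop_atTop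
  have h1 : Tendsto (fun n => F (r (c n)) i) atTop (𝓝 (F p i)) :=
    ((continuous_apply i).tendsto _).comp (hF.tendsto.comp (hlim.comp hctop))
  have hlimi : Tendsto (fun t => r t i) atTop (𝓝 (p i)) :=
    ((continuous_apply i).tendsto _).comp hlim
  have h2 : Tendsto (fun n : ℕ => r (n + 1) i - r n i) atTop (𝓝 (p i - p i)) :=
    (hlimi.comp (tendsto_natCast_atTop_atTop.atTop_add tendsto_const_nhds)).sub
      (hlimi.comp tendsto_natCast_atTop_atTop)
  rw [sub_self] at h2
  simp only [← hval] at h2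
  exact tendsto_nhds_unique h1 h2

/-! ### Dissipative vector fields and stability in the maximum norm -/

section Dissipative

variable {V : Type*} [Fintype V]

theorem norm_sq_le_dotProduct (x : V → ℝ) : ‖x‖ ^ 2 ≤ x ⬝ᵥ x := by
  have h : ‖x‖ ≤ √(x ⬝ᵥ x) := by
    refine (pi_norm_le_iff_of_nonneg (Real.sqrt_nonneg _)).2 fun i => Real.le_sqrt_of_sq_le ?_
    rw [Real.norm_eq_abs, sq_abs, sq]
    exact Finset.single_le_sum (f := fun i => x i * x i) (fun i _ => mul_self_nonneg _)
      (Finset.mem_univ i)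
  calc ‖x‖ ^ 2 ≤ √(x ⬝ᵥ x) ^ 2 := by gcongr
    _ = x ⬝ᵥ x := Real.sq_sqrt (Finset.sum_nonneg fun i _ => mul_self_nonneg _)

theorem abs_dotProduct_le (x y : V → ℝ) : |x ⬝ᵥ y| ≤ Fintype.card V * (‖x‖ * ‖y‖) := by
  calc |x ⬝ᵥ y| ≤ ∑ i, |x i * y i| := Finset.abs_sum_le_sum_abs _ _
    _ ≤ ∑ _i : V, ‖x‖ * ‖y‖ := Finset.sum_le_sum fun i _ => by
        rw [abs_mul]
        exact mul_le_mul (norm_le_pi_norm x i) (norm_le_pi_norm y i) (abs_nonneg _) (norm_nonneg _)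
    _ = Fintype.card V * (‖x‖ * ‖y‖) := by simp

/-- A vector field whose derivative at a zero is negative definite is dissipative nearby. -/
theorem HasFDerivAt.exists_dissipative {F : (V → ℝ) → V → ℝ} {L : (V → ℝ) →L[ℝ] (V → ℝ)}
    {p : V → ℝ} (hF : HasFDerivAt F L p) (hp : F p = 0) (hL : ∀ x, x ≠ 0 → x ⬝ᵥ L x < 0) :
    ∃ a > 0, ∃ ε > 0, ∀ x, ‖x - p‖ ≤ ε → (x - p) ⬝ᵥ F x ≤ -a * ((x - p) ⬝ᵥ (x - p)) := by
  rcases subsingleton_or_nontrivial (V → ℝ) with hV | hV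
  · refine ⟨1, one_pos, 1, one_pos, fun x _ => ?_⟩
    rw [Subsingleton.elim (x - p) 0]
    simp
  have hcont : Continuous fun x : V → ℝ => x ⬝ᵥ L x := by
    unfold dotProduct
    fun_prop
  obtain ⟨z, hz, hmax⟩ := (isCompact_sphere (0 : V → ℝ) 1).exists_isMaxOn
    (NormedSpace.sphere_nonempty.2 zero_le_one) hcont.continuousOn
  have hz0 : z ≠ 0 := by rintro rfl; simp at hz
  set m := -(z ⬝ᵥ L z) with hm
  have hm0 : 0 < m := by have := hL z hz0; linarith
  have hquad : ∀ x, x ⬝ᵥ L x ≤ -m * ‖x‖ ^ 2 := by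
    intro x
    rcases eq_or_ne x 0 with rfl | hx
    · simp
    · have hn := norm_pos_iff.2 hx
      have := hmax (a := ‖x‖⁻¹ • x) (by simp [norm_smul, hn.ne'])
      simp only [map_smul, smul_dotProduct, dotProduct_smul, smul_eq_mul, mem_ofPred_eq] at this
      rw [← mul_assoc, ← mul_inv, ← sq, inv_mul_le_iff₀ (by positivity)] at this
      rw [hm]; linarith
  set N : ℝ := (Fintype.card V : ℝ) with hN
  have hN0 : 0 ≤ N := Nat.cast_nonneg _
  -- This constant serves both as the bound on the Taylor remainder and as the rate: half of `m`
  -- absorbs the remainder, and `N` converts the maximum norm into the Euclidean square; the `+ 1`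
  -- allows `N = 0`.
  have hc : 0 < m / (2 * (N + 1)) := by positivity
  obtain ⟨ε, hε, hball⟩ := Metric.eventually_nhds_iff_ball.1 (hF.isLittleO.def hc)
  refine ⟨m / (2 * (N + 1)), hc, ε / 2, by positivity, fun x hx => ?_⟩
  have hrem := hball x (by rw [mem_ball_iff_norm]; linarith)
  rw [hp, sub_zero] at hrem
  have hd := abs_le.1 (abs_dotProduct_le (x - p) (F x - L (x - p)))
  have hd2 : (x - p) ⬝ᵥ (F x - L (x - p)) ≤ N * (‖x - p‖ * (m / (2 * (N + 1)) * ‖x - p‖)) :=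
    hd.2.trans (by gcongr)
  rw [dotProduct_sub] at hd2
  have hq := hquad (x - p)
  have hdot := (abs_le.1 (abs_dotProduct_le (x - p) (x - p))).2
  have e : m / (2 * (N + 1)) * (N + 1) = m / 2 := by field_simp
  set k := m / (2 * (N + 1))
  have hk : m = 2 * k * (N + 1) := by linarith
  rw [hk] at hq
  nlinarith [mul_nonneg hc.le (sq_nonneg ‖x - p‖), mul_le_mul_of_nonneg_left hdot hc.le]

theorem HasDerivWithinAt.dotProduct_self {r : ℝ → V → ℝ} {r' : V → ℝ} {s : Set ℝ} {t : ℝ}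
    (h : HasDerivWithinAt r r' s t) (p : V → ℝ) :
    HasDerivWithinAt (fun t => (r t - p) ⬝ᵥ (r t - p)) (2 * ((r t - p) ⬝ᵥ r')) s t := by
  have hi : ∀ i, HasDerivWithinAt (fun t => r t i - p i) (r' i) s t := fun i =>
    (hasDerivWithinAt_pi.1 h i).sub_const _
  refine (HasDerivWithinAt.fun_sum fun i (_ : i ∈ Finset.univ) =>
    (hi i).fun_mul (hi i)).congr_deriv ?_
  rw [dotProduct, Finset.mul_sum]
  exact Finset.sum_congr rfl fun i _ => by simp only [Pi.sub_apply]; ring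

/-- For `ε ≥ 0`, coordinatewise truncation retracts the space onto the cube that is the closed
`ε`-ball of the maximum norm. It is used to extend a locally defined field to a bounded, globally
Lipschitz one. -/
theorem lipschitzWith_clamp (p : V → ℝ) (ε : ℝ) :
    LipschitzWith 1 fun (x : V → ℝ) i => max (p i - ε) (min (p i + ε) (x i)) :=
  LipschitzWith.of_dist_le_mul fun x y => by
    refine (dist_pi_le_iff (by positivity)).2 fun i => ?_
    have h := (((LipschitzWith.eval (α := fun _ : V => ℝ) i).const_min (p i + ε)).const_max
      (p i - ε)).dist_le_mul x y
    simpa using h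

/-- Solutions of a dissipative equation starting near the equilibrium exist for all time and
converge to it exponentially fast. -/
theorem exists_solution_of_dissipative {F : (V → ℝ) → V → ℝ} {p : V → ℝ} {a ε : ℝ} {K : ℝ≥0}
    (ha : 0 < a) (hε : 0 < ε) (hF : LipschitzOnWith K F (Metric.closedBall p ε))
    (hdis : ∀ x ∈ Metric.closedBall p ε, (x - p) ⬝ᵥ F x ≤ -a * ((x - p) ⬝ᵥ (x - p)))
    {x₀ : V → ℝ} (hx₀ : (x₀ - p) ⬝ᵥ (x₀ - p) ≤ ε ^ 2) :
    ∃ r : ℝ → V → ℝ, r 0 = x₀ ∧ ∀ t ≥ 0, HasDerivWithinAt r (F (r t)) (Ici 0) t ∧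
      ‖r t - p‖ ≤ ε * Real.exp (-(a / 2) * t) := by
  set c : (V → ℝ) → V → ℝ := fun x i => max (p i - ε) (min (p i + ε) (x i)) with hc
  have hcmem : ∀ x, c x ∈ Metric.closedBall p ε := by
    intro x
    rw [mem_closedBall_iff_norm]
    refine (pi_norm_le_iff_of_nonneg hε.le).2 fun i => abs_le.2 ⟨?_, ?_⟩
    · simp only [Pi.sub_apply, hc]
      linarith [le_max_left (p i - ε) (min (p i + ε) (x i))]
    · have : max (p i - ε) (min (p i + ε) (x i)) ≤ p i + ε :=
        max_le (by linarith) (min_le_left _ _)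
      simp only [Pi.sub_apply, hc]
      linarith
  have hcid : ∀ x ∈ Metric.closedBall p ε, c x = x := by
    intro x hx
    rw [mem_closedBall_iff_norm] at hx
    ext i
    have := abs_le.1 ((norm_le_pi_norm (x - p) i).trans hx)
    simp only [Pi.sub_apply] at this
    simp only [hc]
    rw [min_eq_right (by linarith), max_eq_right (by linarith)]
  have hlip : LipschitzWith (K * 1) fun x => F (c x) := by
    have := hF.comp (lipschitzWith_clamp p ε).lipschitzOnWith (s := univ) fun x _ => hcmem x
    exact lipschitzOnWith_univ.1 this
  obtain ⟨B, hB⟩ := (isCompact_closedBall p ε).exists_bound_of_continuousOn hF.continuousOn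
  obtain ⟨r, hr0, hr⟩ := hlip.exists_hasDerivWithinAt_Ici (L := B.toNNReal)
    (fun x => (hB _ (hcmem x)).trans (Real.le_coe_toNNReal B)) x₀
  have hsmall : ∀ y : V → ℝ, ∀ b, (y - p) ⬝ᵥ (y - p) ≤ b ^ 2 → 0 ≤ b → ‖y - p‖ ≤ b := by
    intro y b hy hb
    exact abs_le_of_sq_le_sq' ((norm_sq_le_dotProduct _).trans hy) hb |>.2
  have hbar : ∀ t ≥ 0, (r t - p) ⬝ᵥ (r t - p) ≤ ε ^ 2 * Real.exp (-a * t) := by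
    intro t ht
    -- Barrier comparison. At a contact point the clamp is inactive and the energy decreases at rate
    -- at least `2 * a`, while the barrier decreases only at rate `a`; the lost factor buys the
    -- strict inequality.
    refine image_le_of_deriv_right_lt_deriv_boundary (a := 0) (b := t)
      (f := fun t => (r t - p) ⬝ᵥ (r t - p)) (f' := fun t => 2 * ((r t - p) ⬝ᵥ F (c (r t))))
      (B := fun t => ε ^ 2 * Real.exp (-a * t)) (B' := fun t => ε ^ 2 * (Real.exp (-a * t) * -a))
      (fun s hs => ((hr s hs.1).dotProduct_self p).continuousWithinAt.mono Icc_subset_Ici_self)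
      (fun s hs => ((hr s hs.1).dotProduct_self p).mono (Ici_subset_Ici.2 hs.1))
      (by simpa [hr0] using hx₀) (fun s => ?_) (fun s hs heq => ?_) ⟨ht, le_rfl⟩
    · have h1 : HasDerivAt (fun s => -a * s) (-a) s := by
        simpa using (hasDerivAt_id s).const_mul (-a)
      exact h1.exp.const_mul _
    · have hle : Real.exp (-a * s) ≤ 1 := Real.exp_le_one_iff.2 (by nlinarith [hs.1])
      have hpos : 0 < ε ^ 2 * Real.exp (-a * s) := by positivity
      have hmem : r s ∈ Metric.closedBall p ε := by
        rw [mem_closedBall_iff_norm]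
        refine hsmall _ _ ?_ hε.le
        rw [heq]
        exact mul_le_of_le_one_right (by positivity) hle
      have := hdis _ hmem
      simp only [hcid _ hmem]
      rw [heq] at this
      nlinarith
  have hexp : ∀ t, ε ^ 2 * Real.exp (-a * t) = (ε * Real.exp (-(a / 2) * t)) ^ 2 := by
    intro t
    rw [mul_pow, ← Real.exp_nat_mul]
    congr 2
    push_cast; ring
  refine ⟨r, hr0, fun t ht => ?_⟩
  have hn : ‖r t - p‖ ≤ ε * Real.exp (-(a / 2) * t) :=
    hsmall _ _ ((hbar t ht).trans_eq (hexp t)) (by positivity)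
  refine ⟨?_, hn⟩
  have hmem : r t ∈ Metric.closedBall p ε := by
    rw [mem_closedBall_iff_norm]
    refine hn.trans (mul_le_of_le_one_right hε.le (Real.exp_le_one_iff.2 ?_))
    nlinarith
  simpa only [hcid _ hmem] using hr t ht

/-- If `K` is monotone decreasing along segments and its derivative at `p` is negative definite,
then `K x` close to `K p` forces `x` close to `p`. -/
theorem exists_norm_sub_lt_of_norm_image_sub_lt {Ω : Set (V → ℝ)} (hΩ : Convex ℝ Ω)
    {K : (V → ℝ) → V → ℝ} (hK : ∀ x ∈ Ω, DifferentiableAt ℝ K x)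
    (hneg : ∀ x ∈ Ω, ∀ y, y ≠ 0 → y ⬝ᵥ fderiv ℝ K x y < 0) {p : V → ℝ} (hp : p ∈ Ω) {η : ℝ}
    (hη : 0 < η) : ∃ δ > 0, ∀ x ∈ Ω, ‖K x - K p‖ < δ → ‖x - p‖ < η := by
  obtain ⟨a, ha, ε, hε, hdis⟩ := HasFDerivAt.exists_dissipative (F := fun x => K x - K p) (p := p)
    ((hK p hp).hasFDerivAt.sub_const _) (sub_self _) (hneg p hp)
  set N : ℝ := (Fintype.card V : ℝ) with hN
  have hN0 : 0 ≤ N := Nat.cast_nonneg _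
  set μ := min η ε with hμ
  have hμ0 : 0 < μ := lt_min hη hε
  refine ⟨a * μ / (N + 1), by positivity, fun x hx hKx => ?_⟩
  by_contra hfar
  rw [not_lt] at hfar
  set y := x - p with hy
  have hμy : μ ≤ ‖y‖ := (min_le_left _ _).trans hfar
  have hy0 : 0 < ‖y‖ := hμ0.trans_le hμy
  -- Places `p + s • y` at distance exactly `μ` from `p`, inside the region where dissipativity
  -- gives a definite drop of `y ⬝ᵥ K`. Monotonicity along the segment carries that drop on to `x`.
  set s := μ / ‖y‖ with hs
  have hs0 : 0 < s := by positivity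
  have hs1 : s ≤ 1 := (div_le_one hy0).2 hμy
  have hseg : ∀ u ∈ Icc (0 : ℝ) 1, p + u • y ∈ Ω := fun u hu => by
    have := hΩ.add_smul_sub_mem hp hx hu
    exact this
  have hder : ∀ u ∈ Icc (0 : ℝ) 1, HasDerivAt (fun u : ℝ => y ⬝ᵥ K (p + u • y))
      (y ⬝ᵥ fderiv ℝ K (p + u • y) y) u := by
    intro u hu
    have hline : HasDerivAt (fun u : ℝ => p + u • y) y u := by
      simpa using ((hasDerivAt_id u).smul_const y).const_add p
    have h := (hK _ (hseg u hu)).hasFDerivAt.comp_hasDerivAt u hline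
    exact HasDerivAt.fun_sum fun i _ => (hasDerivAt_pi.1 h i).const_mul (y i)
  have hanti : AntitoneOn (fun u : ℝ => y ⬝ᵥ K (p + u • y)) (Icc 0 1) := by
    refine antitoneOn_of_deriv_nonpos (convex_Icc 0 1)
      (fun u hu => (hder u hu).continuousAt.continuousWithinAt)
      (fun u hu => (hder u (interior_subset hu)).differentiableAt.differentiableWithinAt)
      fun u hu => ?_
    rw [(hder u (interior_subset hu)).deriv]
    exact (hneg _ (hseg u (interior_subset hu)) y (norm_pos_iff.1 hy0)).le
  have h1 := hanti ⟨hs0.le, hs1⟩ ⟨zero_le_one, le_rfl⟩ hs1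
  have hx1 : p + (1 : ℝ) • y = x := by rw [one_smul, hy]; abel
  simp only [hx1] at h1
  have hns : ‖s • y‖ = μ := by
    rw [norm_smul, Real.norm_of_nonneg hs0.le, hs]; field_simp
  have h2 := hdis (p + s • y) (by rw [add_sub_cancel_left, hns]; exact min_le_right _ _)
  rw [add_sub_cancel_left] at h2
  have h3 := norm_sq_le_dotProduct (s • y)
  rw [hns] at h3
  have h4 : s * (y ⬝ᵥ (K (p + s • y) - K p)) ≤ -a * μ ^ 2 := by
    rw [smul_dotProduct, smul_eq_mul] at h2
    nlinarith
  have h5 : y ⬝ᵥ (K x - K p) ≤ y ⬝ᵥ (K (p + s • y) - K p) := by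
    rw [dotProduct_sub, dotProduct_sub]; linarith
  have h6 : s * (y ⬝ᵥ (K x - K p)) ≤ -a * μ ^ 2 := (mul_le_mul_of_nonneg_left h5 hs0.le).trans h4
  have h7 := (abs_le.1 (abs_dotProduct_le y (K x - K p))).1
  have h8 : s * ‖y‖ = μ := by rw [hs]; field_simp
  have h9 : a * μ ^ 2 ≤ N * (μ * ‖K x - K p‖) := by
    have := mul_le_mul_of_nonneg_left h7 hs0.le
    have e : s * -(↑(Fintype.card V) * (‖y‖ * ‖K x - K p‖)) = -(N * (μ * ‖K x - K p‖)) := by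
      rw [← h8]; ring
    rw [e] at this
    linarith
  have h10 : a * μ ≤ N * ‖K x - K p‖ := by
    have : (a * μ) * μ ≤ (N * ‖K x - K p‖) * μ := by linarith
    exact le_of_mul_le_mul_right this hμ0
  have h11 : (N + 1) * ‖K x - K p‖ < a * μ := by
    rwa [lt_div_iff₀' (by positivity)] at hKx
  linarith [norm_nonneg (K x - K p)]

end Dissipative

/-! ### Convergence of the Ricci and Calabi flows -/

namespace FacePairing

variable {T : Type*} [Finite T] (G : FacePairing T)

/-- A `C¹` flow is exponentially stable at a zero where its derivative is negative definite. -/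
theorem exists_flowConvergesExp {F : (G.Vertex → ℝ) → G.Vertex → ℝ}
    (hF : ∀ r, G.IsMetric r → ContDiffAt ℝ 1 F r) {p : G.Vertex → ℝ} (hp : G.IsMetric p)
    (hFp : F p = 0) (hneg : ∀ x, x ≠ 0 → x ⬝ᵥ fderiv ℝ F p x < 0) :
    ∃ η > 0, ∀ r₀, G.IsMetric r₀ → ‖r₀ - p‖ < η → G.FlowConvergesExp F r₀ p := by
  obtain ⟨a, ha, ε₁, hε₁, hdis⟩ :=
    ((hF p hp).differentiableAt one_ne_zero).hasFDerivAt.exists_dissipative hFp hneg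
  obtain ⟨K, s, hs, hK⟩ := (hF p hp).exists_lipschitzOnWith
  obtain ⟨ε₂, hε₂, hball⟩ := Metric.nhds_basis_closedBall.mem_iff.1
    (inter_mem hs (G.isOpen_isMetric.mem_nhds hp))
  set ε := min ε₁ ε₂ with hε
  have hε0 : 0 < ε := lt_min hε₁ hε₂
  have hsub : Metric.closedBall p ε ⊆ s ∩ {r | G.IsMetric r} :=
    (Metric.closedBall_subset_closedBall (min_le_right _ _)).trans hball
  set N : ℝ := (Fintype.card G.Vertex : ℝ) with hN
  have hN0 : 0 ≤ N := Nat.cast_nonneg _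
  -- The factor `N + 1` makes the Euclidean square of `r₀ - p` at most `ε ^ 2`, the starting
  -- condition of the energy estimate.
  refine ⟨ε / (N + 1), by positivity, fun r₀ _ hr₀ => ?_⟩
  have hsq : (r₀ - p) ⬝ᵥ (r₀ - p) ≤ ε ^ 2 := by
    have h1 := (abs_le.1 (abs_dotProduct_le (r₀ - p) (r₀ - p))).2
    rw [lt_div_iff₀ (by positivity)] at hr₀
    have h2 : (‖r₀ - p‖ * (N + 1)) ^ 2 ≤ ε ^ 2 := by gcongr
    nlinarith [mul_nonneg hN0 (sq_nonneg ‖r₀ - p‖), sq_nonneg ‖r₀ - p‖,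
      mul_nonneg (sq_nonneg N) (sq_nonneg ‖r₀ - p‖)]
  obtain ⟨r, hr0, hr⟩ := exists_solution_of_dissipative ha hε0 (hK.mono fun x hx => (hsub hx).1)
    (fun x hx => hdis x ((mem_closedBall_iff_norm.1 hx).trans (min_le_left _ _))) hsq
  have hflow : G.IsFlow F (Ici 0) r := fun t ht => by
    obtain ⟨h1, h2⟩ := hr t ht
    refine ⟨(hsub (mem_closedBall_iff_norm.2 (h2.trans ?_))).2, h1⟩
    refine mul_le_of_le_one_right hε0.le (Real.exp_le_one_iff.2 ?_)
    have : 0 ≤ t := ht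
    nlinarith
  -- Local Lipschitz continuity on all metrics, not only near `p`, because a competing solution may
  -- a priori leave the small ball.
  have hlip : LocallyLipschitzOn {r | G.IsMetric r} F :=
    ContDiffOn.locallyLipschitzOn G.convex_isMetric fun x hx => (hF x hx).contDiffWithinAt
  refine ⟨r, hr0, hflow, fun S q _ hq0 hq => ?_, ε, hε0, a / 2, by positivity,
    fun t ht => (hr t ht).2⟩
  exact hlip.eqOn_of_hasDerivWithinAt hq
    (fun t ht => ⟨(hflow t ht.1).1, (hflow t ht.1).2.mono Ico_subset_Ici_self⟩)
    (hq0.trans hr0.symm)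

theorem dotProduct_fderiv_neg {r : G.Vertex → ℝ} (hr : G.IsMetric r) {x : G.Vertex → ℝ}
    (hx : x ≠ 0) : x ⬝ᵥ fderiv ℝ G.scalarCurvature r x < 0 := by
  have := Fintype.ofFinite T
  rw [G.dotProduct_fderiv_scalarCurvature hr]
  exact neg_neg_of_pos (G.hessianForm_pos hr hx)

theorem dotProduct_fderiv_comm {r : G.Vertex → ℝ} (hr : G.IsMetric r) (x z : G.Vertex → ℝ) :
    z ⬝ᵥ fderiv ℝ G.scalarCurvature r x = x ⬝ᵥ fderiv ℝ G.scalarCurvature r z := by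
  have := Fintype.ofFinite T
  rw [G.dotProduct_fderiv_scalarCurvature hr, G.dotProduct_fderiv_scalarCurvature hr,
    G.hessianForm_symm hr]

theorem contDiffAt_ricciField (Kbar : G.Vertex → ℝ) {r : G.Vertex → ℝ} (hr : G.IsMetric r) :
    ContDiffAt ℝ 1 (G.ricciField Kbar) r := by
  have := Fintype.ofFinite T
  exact (G.contDiffAt_scalarCurvature hr).sub contDiffAt_const

/-- Replaces the matrix of partial derivatives by `fderiv` near `r`, so that smoothness of `K` gives
smoothness of the field. -/
theorem calabiField_eventuallyEq (Kbar : G.Vertex → ℝ) {r : G.Vertex → ℝ} (hr : G.IsMetric r) :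
    G.calabiField Kbar =ᶠ[𝓝 r]
      fun x => -fderiv ℝ G.scalarCurvature x (G.scalarCurvature x - Kbar) := by
  have := Fintype.ofFinite T
  exact (G.eventually_isMetric hr).mono fun x hx => by
    rw [calabiField, G.laplacian_mulVec hx]

theorem contDiffAt_fderiv_scalarCurvature {r : G.Vertex → ℝ} (hr : G.IsMetric r) :
    ContDiffAt ℝ 1 (fderiv ℝ G.scalarCurvature) r := by
  have := Fintype.ofFinite T
  exact (G.contDiffAt_scalarCurvature (n := 2) hr).fderiv_right (by norm_num)

theorem contDiffAt_calabiField (Kbar : G.Vertex → ℝ) {r : G.Vertex → ℝ} (hr : G.IsMetric r) :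
    ContDiffAt ℝ 1 (G.calabiField Kbar) r :=
  ((G.contDiffAt_fderiv_scalarCurvature hr).clm_apply
    (G.contDiffAt_ricciField Kbar hr)).neg.congr_of_eventuallyEq (G.calabiField_eventuallyEq Kbar hr)

theorem fderiv_ricciField (Kbar r : G.Vertex → ℝ) :
    fderiv ℝ (G.ricciField Kbar) r = fderiv ℝ G.scalarCurvature r :=
  fderiv_sub_const Kbar

/-- In the product rule, the term differentiating the Laplacian carries the factor `K - Kbar`, which
vanishes at `r`. -/
theorem fderiv_calabiField {Kbar r : G.Vertex → ℝ} (hr : G.IsMetric r)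
    (hK : G.scalarCurvature r = Kbar) (x : G.Vertex → ℝ) :
    fderiv ℝ (G.calabiField Kbar) r x =
      -fderiv ℝ G.scalarCurvature r (fderiv ℝ G.scalarCurvature r x) := by
  have h1 := ((G.contDiffAt_fderiv_scalarCurvature hr).differentiableAt one_ne_zero).hasFDerivAt
  have h2 := ((G.contDiffAt_ricciField Kbar hr).differentiableAt one_ne_zero).hasFDerivAt
  have h3 := (h1.clm_apply h2).neg
  have h4 := h3.congr_of_eventuallyEq (G.calabiField_eventuallyEq Kbar hr)
  have h0 : G.ricciField Kbar r = 0 := by rw [ricciField, hK, sub_self]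
  rw [h4.fderiv, fderiv_ricciField, h0]
  simp

/-- A limit of one of the flows has the prescribed curvature. -/
theorem scalarCurvature_eq_of_tendsto {Kbar p : G.Vertex → ℝ} {r : ℝ → G.Vertex → ℝ}
    (hr : G.IsFlow (G.ricciField Kbar) (Ici 0) r ∨ G.IsFlow (G.calabiField Kbar) (Ici 0) r)
    (hp : G.IsMetric p) (hlim : Tendsto r atTop (𝓝 p)) : G.scalarCurvature p = Kbar := by
  rw [← sub_eq_zero]
  rcases hr with hr | hr
  · exact eq_zero_of_tendsto_of_hasDerivWithinAt (F := G.ricciField Kbar)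
      (G.contDiffAt_ricciField Kbar hp).continuousAt (fun t ht => (hr t ht).2) hlim
  · have h := eq_zero_of_tendsto_of_hasDerivWithinAt
      (G.contDiffAt_calabiField Kbar hp).continuousAt (fun t ht => (hr t ht).2) hlim
    -- An equilibrium of the Calabi flow only satisfies `DK (K - Kbar) = 0`; definiteness of `DK`
    -- removes the kernel.
    rw [(G.calabiField_eventuallyEq Kbar hp).eq_of_nhds, neg_eq_zero] at h
    by_contra hne
    have := G.dotProduct_fderiv_neg hp hne
    rw [h, dotProduct_zero] at this
    exact this.false

theorem exists_flows_convergeExp {Kbar p : G.Vertex → ℝ} (hp : G.IsMetric p)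
    (hK : G.scalarCurvature p = Kbar) : ∃ δ > 0, ∀ r₀, G.IsMetric r₀ →
      ‖G.scalarCurvature r₀ - Kbar‖ < δ →
        G.FlowConvergesExp (G.ricciField Kbar) r₀ p ∧
        G.FlowConvergesExp (G.calabiField Kbar) r₀ p := by
  have := Fintype.ofFinite T
  have h0 : G.ricciField Kbar p = 0 := by rw [ricciField, hK, sub_self]
  have h0' : G.calabiField Kbar p = 0 := by rw [calabiField, hK, sub_self, Matrix.mulVec_zero, neg_zero]
  obtain ⟨η₁, hη₁, h₁⟩ := G.exists_flowConvergesExp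
    (fun r hr => G.contDiffAt_ricciField Kbar hr) hp h0
    (fun x hx => by rw [fderiv_ricciField]; exact G.dotProduct_fderiv_neg hp hx)
  obtain ⟨η₂, hη₂, h₂⟩ := G.exists_flowConvergesExp
    (fun r hr => G.contDiffAt_calabiField Kbar hr) hp h0' (fun x hx => by
      -- By symmetry of `DK`, the quadratic form of `-(DK)²` at `x` is minus the Euclidean square of
      -- `DK x`, and `DK` is injective.
      rw [G.fderiv_calabiField hp hK, dotProduct_neg, G.dotProduct_fderiv_comm hp,
        neg_lt_zero]
      have hne : fderiv ℝ G.scalarCurvature p x ≠ 0 := fun h => by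
        have := G.dotProduct_fderiv_neg hp hx
        rw [h, dotProduct_zero] at this
        exact this.false
      have h := norm_sq_le_dotProduct (fderiv ℝ G.scalarCurvature p x)
      have := norm_pos_iff.2 hne
      exact lt_of_lt_of_le (by positivity) h)
  obtain ⟨δ, hδ, h⟩ := exists_norm_sub_lt_of_norm_image_sub_lt G.convex_isMetric
    (fun r hr => (G.contDiffAt_scalarCurvature (n := 1) hr).differentiableAt one_ne_zero)
    (fun r hr y hy => G.dotProduct_fderiv_neg hr hy) hp (lt_min hη₁ hη₂)
  refine ⟨δ, hδ, fun r₀ hr₀ hlt => ?_⟩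
  rw [← hK] at hlt
  have hn := h r₀ hr₀ hlt
  exact ⟨h₁ r₀ hr₀ (hn.trans_le (min_le_left _ _)), h₂ r₀ hr₀ (hn.trans_le (min_le_right _ _))⟩

end FacePairing

theorem theorem5p1 {M : Type*} [TopologicalSpace M] [T2Space M] [CompactSpace M]
    [ChartedSpace (EuclideanHalfSpace 3) M] {T : Type*} [Finite T]
    (𝒯 : IdealTriangulation M T) (Kbar : 𝒯.Vertex → ℝ) :
    ((∃ r : ℝ → 𝒯.Vertex → ℝ,
        (𝒯.IsFlow (𝒯.ricciField Kbar) (Ici 0) r ∨ 𝒯.IsFlow (𝒯.calabiField Kbar) (Ici 0) r) ∧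
        ∃ rlim, 𝒯.IsMetric rlim ∧ Tendsto r atTop (𝓝 rlim)) →
      ∃ rbar, 𝒯.IsMetric rbar ∧ 𝒯.scalarCurvature rbar = Kbar) ∧
    ∀ rbar, 𝒯.IsMetric rbar → 𝒯.scalarCurvature rbar = Kbar →
      ∃ δ > 0, ∀ r₀, 𝒯.IsMetric r₀ → ‖𝒯.scalarCurvature r₀ - Kbar‖ < δ →
        𝒯.FlowConvergesExp (𝒯.ricciField Kbar) r₀ rbar ∧
        𝒯.FlowConvergesExp (𝒯.calabiField Kbar) r₀ rbar := by
  exact ⟨fun ⟨_, hr, rlim, hm, hlim⟩ => ⟨rlim, hm, 𝒯.scalarCurvature_eq_of_tendsto hr hm hlim⟩,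
    fun _ hm hK => 𝒯.exists_flows_convergeExp hm hK⟩
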